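/- Let $n,r\ge 1$ and let $S\in\{\pm1\}^{n\times r}$ be a sign matrix whose permeance $$\nu(S)=\tfrac1n\,\lambda_{\min}(S^{\mathsf t}S)=\tfrac1n\min_{\|u\|_{\ell_2}=1}\|Su\|_{\ell_2}^2$$ is positive, and let $m\ge r$ be a natural number. Let $L_0\in\mathbb R^{n\times m}$ be drawn from the Gaussian loadings model $\mathrm{GLM}(S,m)$, that is, $L_0$ has the law of $r^{-1/2}SG^{\mathsf t}$, where $G\in\mathbb R^{m\times r}$ is a standard normal matrix (independent $N(0,1)$ entries). For a matrix $L\in\mathbb R^{n\times m}$ of rank $\rho\geq 1$ with (compact) singular value decomposition $L=U\Sigma V^{\mathsf t}$, $U\in\mathbb R^{n\times \rho}$, $V\in\mathbb R^{m\times \rho}$, put $$\mu_{(l)}(L)=\tfrac n\rho\max_{k\le n}\|P_{\mathrm{ran}(L)}e_k\|_{\ell_2}^2,\qquad \mu_{(r)}(L)=\tfrac m\rho\max_{l\le m}\|P_{\mathrm{ran}(L^{\mathsf t})}e_l\|_{\ell_2}^2,\qquad \tilde\mu(L)=\tfrac{nm}\rho\max_{k\le n,\,l\le m}|\langle e_k,UV^{\mathsf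 t}e_l\rangle|^2,$$ where $P$ denotes the orthogonal projector onto the indicated subspace ($UV^{\mathsf t}$ does not depend on the choice of the decomposition). Then $L_0$ has rank $r$ almost surely. The bound $$\mu_{(l)}(L_0)\le\nu(S)^{-1}$$ holds almost surely; more precisely, it holds deterministically for $L_0=r^{-1/2}SG^{\mathsf t}$ whenever $G\in\mathbb R^{m\times r}$ has rank $r$. Moreover, for every $\alpha>0$, $$\Pr\bigl[\mu_{(r)}(L_0)\ge 4(\alpha+1)\log(n+m)\bigr]\le \frac{2(nm)^{-\alpha}}{n},\qquad \Pr\Bigl[\tilde\mu(L_0)\ge \tfrac{4(\alpha+1)}{\nu(S)}\log(n+m)\Bigr]\le 2(nm)^{-\alpha},$$ where $\log$ is the natural logarithm. -/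

import Mathlib

open MeasureTheory ProbabilityTheory Matrix
open scoped ENNReal

namespace GaussianLoadings

noncomputable section

/-- The Borel (product) σ-algebra on real matrices. -/
instance instMeasurableSpaceRealMatrix (n m : ℕ) :
    MeasurableSpace (Matrix (Fin n) (Fin m) ℝ) :=
  inferInstanceAs (MeasurableSpace (Fin n → Fin m → ℝ))

/-- A sign matrix: every entry is `1` or `-1`. -/
def IsSignMatrix {n r : ℕ} (S : Matrix (Fin n) (Fin r) ℝ) : Prop :=
  ∀ i j, S i j = 1 ∨ S i j = -1

/-- The permeance statistic `ν(S) = (1/n) min_{‖u‖ = 1} ‖S u‖²` (Euclidean norms); equivalently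
`1/n` times the smallest eigenvalue of `Sᵀ S`.  For `n = 0` or `r = 0` its value is `0`. -/
def permeance {n r : ℕ} (S : Matrix (Fin n) (Fin r) ℝ) : ℝ :=
  (1 / (n : ℝ)) *
    ⨅ u : Metric.sphere (0 : EuclideanSpace ℝ (Fin r)) 1, ‖Matrix.toEuclideanLin S u‖ ^ 2

/-- The law of the `m × r` standard normal matrix: independent `N(0,1)` entries. -/
def stdNormalMatrix (m r : ℕ) : Measure (Matrix (Fin m) (Fin r) ℝ) :=
  Measure.pi fun _ : Fin m => Measure.pi fun _ : Fin r => gaussianReal 0 1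

/-- The matrix `r^{-1/2} S Gᵀ`. -/
def loadingsMatrix {n r m : ℕ} (S : Matrix (Fin n) (Fin r) ℝ) (G : Matrix (Fin m) (Fin r) ℝ) :
    Matrix (Fin n) (Fin m) ℝ :=
  (1 / √(r : ℝ)) • (S * Gᵀ)

theorem measurable_loadingsMatrix {n r m : ℕ} (S : Matrix (Fin n) (Fin r) ℝ) :
    Measurable (loadingsMatrix (m := m) S) := by
  refine measurable_pi_lambda _ fun i => measurable_pi_lambda _ fun j => ?_
  simp only [loadingsMatrix, Matrix.smul_apply, Matrix.mul_apply, Matrix.transpose_apply,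
    smul_eq_mul]
  exact (Finset.measurable_sum _ fun k _ => ((measurable_pi_apply k).comp
    (measurable_pi_apply (X := fun _ : Fin m => Fin r → ℝ) j)).const_mul _).const_mul _

/-- The Gaussian loadings model `GLM(S, m)`: the law of `r^{-1/2} S Gᵀ` where `G` is an `m × r`
standard normal matrix. -/
def GLM {n r : ℕ} (S : Matrix (Fin n) (Fin r) ℝ) (m : ℕ) : Measure (Matrix (Fin n) (Fin m) ℝ) :=
  (stdNormalMatrix m r).map (loadingsMatrix S)

instance isProbabilityMeasure_GLM {n r : ℕ} (S : Matrix (Fin n) (Fin r) ℝ) (m : ℕ) :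
    IsProbabilityMeasure (GLM S m) := by
  have : IsProbabilityMeasure (stdNormalMatrix m r) := by
    unfold stdNormalMatrix
    exact inferInstanceAs (IsProbabilityMeasure
      (Measure.pi fun _ : Fin m => Measure.pi fun _ : Fin r => gaussianReal 0 1))
  exact Measure.isProbabilityMeasure_map (measurable_loadingsMatrix S).aemeasurable

/-- The range (column space) of a matrix, as a subspace of Euclidean space. -/
def ran {n m : ℕ} (L : Matrix (Fin n) (Fin m) ℝ) : Submodule ℝ (EuclideanSpace ℝ (Fin n)) :=
  LinearMap.range (Matrix.toEuclideanLin L)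

/-- Left incoherence `(n / rank L) max_k ‖P_{ran L} e_k‖²`. -/
def leftIncoherence {n m : ℕ} (L : Matrix (Fin n) (Fin m) ℝ) : ℝ :=
  ((n : ℝ) / (L.rank : ℝ)) *
    ⨆ k : Fin n, ‖(ran L).starProjection (EuclideanSpace.single k (1 : ℝ))‖ ^ 2

/-- Right incoherence `(m / rank L) max_l ‖P_{ran Lᵀ} e_l‖²`. -/
def rightIncoherence {n m : ℕ} (L : Matrix (Fin n) (Fin m) ℝ) : ℝ :=
  ((m : ℝ) / (L.rank : ℝ)) *
    ⨆ l : Fin m, ‖(ran Lᵀ).starProjection (EuclideanSpace.single l (1 : ℝ))‖ ^ 2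

/-- `L = U diag(σ) Vᵀ` is a compact singular value decomposition: `U`, `V` have `rank L`
orthonormal columns and all the `σ i` are positive.  (No order is imposed on the `σ i`: permuting
them together with the columns of `U` and `V` does not change `U Vᵀ`.) -/
structure IsSVD {n m : ℕ} (L : Matrix (Fin n) (Fin m) ℝ) (U : Matrix (Fin n) (Fin L.rank) ℝ)
    (σ : Fin L.rank → ℝ) (V : Matrix (Fin m) (Fin L.rank) ℝ) : Prop where
  left_orthonormal : Uᵀ * U = 1
  right_orthonormal : Vᵀ * V = 1
  pos : ∀ i, 0 < σ i
  eq : L = U * Matrix.diagonal σ * Vᵀ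

theorem exists_isSVD {n m : ℕ} (L : Matrix (Fin n) (Fin m) ℝ) :
    ∃ U σ V, IsSVD L U σ V := by
  have hA : (Lᵀ * L).IsHermitian := by
    simpa using Matrix.isHermitian_conjTranspose_mul_self L
  have hpsd : (Lᵀ * L).PosSemidef := by
    simpa using Matrix.posSemidef_conjTranspose_mul_self L
  have hcard : Fintype.card {i // hA.eigenvalues i ≠ 0} = Fintype.card (Fin L.rank) := by
    rw [← hA.rank_eq_card_non_zero_eigs, Matrix.rank_transpose_mul_self, Fintype.card_fin]
  let e : Fin L.rank ≃ {i // hA.eigenvalues i ≠ 0} := (Fintype.equivOfCardEq hcard).symm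
  let Q : Matrix (Fin m) (Fin m) ℝ := hA.eigenvectorUnitary
  have hQ1 : Qᵀ * Q = 1 := by
    simpa [Q, Matrix.star_eq_conjTranspose] using Unitary.coe_star_mul_self hA.eigenvectorUnitary
  have hQ2 : Q * Qᵀ = 1 := by
    simpa [Q, Matrix.star_eq_conjTranspose] using Unitary.coe_mul_star_self hA.eigenvectorUnitary
  have hspec : Qᵀ * (Lᵀ * L) * Q = Matrix.diagonal hA.eigenvalues := by
    have h2 : Lᵀ * L = Q * Matrix.diagonal hA.eigenvalues * Qᵀ := by
      simpa [Q, Unitary.conjStarAlgAut_apply, Matrix.star_eq_conjTranspose, Function.comp_def]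
        using hA.spectral_theorem
    calc Qᵀ * (Lᵀ * L) * Q = Qᵀ * (Q * Matrix.diagonal hA.eigenvalues * Qᵀ) * Q :=
          congrArg (fun X => Qᵀ * X * Q) h2
      _ = (Qᵀ * Q) * Matrix.diagonal hA.eigenvalues * (Qᵀ * Q) := by
          simp only [Matrix.mul_assoc]
      _ = _ := by rw [hQ1]; simp
  have hent : ∀ i j, ((L * Q)ᵀ * (L * Q)) i j = Matrix.diagonal hA.eigenvalues i j := by
    intro i j
    rw [← hspec, Matrix.transpose_mul]
    simp only [Matrix.mul_assoc]
  have hpos : ∀ i, 0 < hA.eigenvalues (e i) := fun i =>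
    lt_of_le_of_ne (hpsd.eigenvalues_nonneg _) (Ne.symm (e i).2)
  let σ : Fin L.rank → ℝ := fun i => √(hA.eigenvalues (e i))
  have hσ : ∀ i, 0 < σ i := fun i => Real.sqrt_pos.2 (hpos i)
  have hσ2 : ∀ i, σ i * σ i = hA.eigenvalues (e i) := fun i => Real.mul_self_sqrt (hpos i).le
  refine ⟨Matrix.of fun a i => (L * Q) a (e i) / σ i, σ, Matrix.of fun a i => Q a (e i),
    ?_, ?_, hσ, ?_⟩
  · ext i j
    have h := hent (e i) (e j)
    simp only [Matrix.mul_apply (M := (L * Q)ᵀ), Matrix.transpose_apply] at h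
    simp only [Matrix.mul_apply (N := Matrix.of fun a i => (L * Q) a (e i) / σ i),
      Matrix.transpose_apply, Matrix.of_apply, div_mul_div_comm]
    rw [← Finset.sum_div, h]
    by_cases hij : i = j
    · subst hij
      rw [Matrix.diagonal_apply_eq, hσ2, Matrix.one_apply_eq, div_self (hpos i).ne']
    · have : (e i : Fin m) ≠ e j := fun h => hij (e.injective (Subtype.ext h))
      rw [Matrix.diagonal_apply_ne _ this, Matrix.one_apply_ne hij, zero_div]
  · ext i j
    have h : (Qᵀ * Q) (e i) (e j) = (1 : Matrix (Fin m) (Fin m) ℝ) (e i) (e j) := by rw [hQ1]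
    rw [Matrix.mul_apply] at h ⊢
    simp only [Matrix.transpose_apply, Matrix.of_apply] at h ⊢
    rw [h]
    by_cases hij : i = j
    · subst hij; simp
    · have : (e i : Fin m) ≠ e j := fun h => hij (e.injective (Subtype.ext h))
      rw [Matrix.one_apply_ne this, Matrix.one_apply_ne hij]
  · have hz : ∀ a i, hA.eigenvalues i = 0 → (L * Q) a i = 0 := by
      intro a i hi
      have h := hent i i
      rw [Matrix.diagonal_apply_eq, hi, Matrix.mul_apply] at h
      simp only [Matrix.transpose_apply] at h
      have := (Finset.sum_eq_zero_iff_of_nonneg (fun a _ => mul_self_nonneg _)).1 h a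
        (Finset.mem_univ a)
      exact mul_self_eq_zero.1 this
    ext a b
    have h1 : L a b = ∑ i, (L * Q) a i * Q b i := by
      have : L = (L * Q) * Qᵀ := by rw [Matrix.mul_assoc, hQ2, Matrix.mul_one]
      conv_lhs => rw [this, Matrix.mul_apply]
      rfl
    have h2 : ∑ i, (L * Q) a i * Q b i
        = ∑ i : {i // hA.eigenvalues i ≠ 0}, (L * Q) a i * Q b i := by
      rw [← Finset.sum_subtype (Finset.univ.filter fun i => hA.eigenvalues i ≠ 0) (by simp)
        (fun i => (L * Q) a i * Q b i), Finset.sum_filter_of_ne]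
      intro i _ hne h0
      exact hne (by rw [hz a i h0, zero_mul])
    rw [h1, h2, ← e.sum_comp, Matrix.mul_apply]
    refine Finset.sum_congr rfl fun i _ => ?_
    rw [Matrix.mul_diagonal]
    simp only [Matrix.transpose_apply, Matrix.of_apply]
    rw [div_mul_cancel₀ _ (hσ i).ne']

open scoped MatrixOrder Matrix.Norms.L2Operator in
/-- The product `U Vᵀ` does not depend on the singular value decomposition. -/
theorem IsSVD.mul_transpose_unique {n m : ℕ} {L : Matrix (Fin n) (Fin m) ℝ}
    {U U' : Matrix (Fin n) (Fin L.rank) ℝ} {σ σ' : Fin L.rank → ℝ}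
    {V V' : Matrix (Fin m) (Fin L.rank) ℝ} (h : IsSVD L U σ V) (h' : IsSVD L U' σ' V') :
    U * Vᵀ = U' * V'ᵀ := by
  -- the absolute value `H = V Σ Vᵀ` of `L` and its pseudo-inverse `K`
  have key : ∀ {U : Matrix (Fin n) (Fin L.rank) ℝ} {σ : Fin L.rank → ℝ}
      {V : Matrix (Fin m) (Fin L.rank) ℝ}, IsSVD L U σ V →
      (V * diagonal σ * Vᵀ).PosSemidef ∧ (V * diagonal σ * Vᵀ) ^ 2 = Lᵀ * L ∧
      L = U * Vᵀ * (V * diagonal σ * Vᵀ) ∧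
      V * Vᵀ * (V * diagonal σ * Vᵀ) = V * diagonal σ * Vᵀ ∧
      (V * diagonal σ * Vᵀ) * (V * diagonal (fun i => (σ i)⁻¹) * Vᵀ) = V * Vᵀ ∧
      U * Vᵀ * (V * Vᵀ) = U * Vᵀ := by
    intro U σ V h
    have hV : ∀ {k : ℕ} (X : Matrix (Fin L.rank) (Fin k) ℝ), Vᵀ * (V * X) = X := by
      intro k X; rw [← Matrix.mul_assoc, h.right_orthonormal, Matrix.one_mul]
    have hU : ∀ {k : ℕ} (X : Matrix (Fin L.rank) (Fin k) ℝ), Uᵀ * (U * X) = X := by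
      intro k X; rw [← Matrix.mul_assoc, h.left_orthonormal, Matrix.one_mul]
    refine ⟨?_, ?_, ?_, ?_, ?_, ?_⟩
    · have := (Matrix.PosSemidef.diagonal (fun i => (h.pos i).le)).mul_mul_conjTranspose_same V
      simpa using this
    · have e1 : Lᵀ * L = (U * diagonal σ * Vᵀ)ᵀ * (U * diagonal σ * Vᵀ) :=
        congrArg (fun X => Xᵀ * X) h.eq
      rw [e1, pow_two]
      simp only [Matrix.transpose_mul, Matrix.transpose_transpose, Matrix.diagonal_transpose,
        Matrix.mul_assoc, hV, hU]
    · simp only [Matrix.mul_assoc, hV]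
      simpa only [Matrix.mul_assoc] using h.eq
    · simp only [Matrix.mul_assoc, hV]
    · have e2 : diagonal σ * diagonal (fun i => (σ i)⁻¹) = 1 := by
        rw [Matrix.diagonal_mul_diagonal]
        simp [(h.pos _).ne']
      simp only [Matrix.mul_assoc, hV]
      rw [← Matrix.mul_assoc (diagonal σ), e2, Matrix.one_mul]
    · simp only [Matrix.mul_assoc, hV]
  obtain ⟨a1, a2, a3, a4, a5, a6⟩ := key h
  obtain ⟨b1, b2, b3, b4, b5, b6⟩ := key h'
  have hH : V * diagonal σ * Vᵀ = V' * diagonal σ' * V'ᵀ := by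
    have e1 := CFC.sqrt_unique (a := Lᵀ * L) (b := V * diagonal σ * Vᵀ)
      (by rw [← a2, pow_two]) a1.nonneg
    have e2 := CFC.sqrt_unique (a := Lᵀ * L) (b := V' * diagonal σ' * V'ᵀ)
      (by rw [← b2, pow_two]) b1.nonneg
    rw [← e1, ← e2]
  rw [← hH] at b3 b4 b5
  have p1 : V' * V'ᵀ * (V * Vᵀ) = V * Vᵀ := by
    rw [← a5, ← Matrix.mul_assoc, b4]
  have p2 : V * Vᵀ * (V' * V'ᵀ) = V' * V'ᵀ := by
    rw [← b5, ← Matrix.mul_assoc, a4]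
  have p3 : V * Vᵀ = V' * V'ᵀ := by
    have := congrArg Matrix.transpose p1
    simp only [Matrix.transpose_mul, Matrix.transpose_transpose] at this
    rw [← this, p2]
  have q : U * Vᵀ * (V * diagonal σ * Vᵀ) = U' * V'ᵀ * (V * diagonal σ * Vᵀ) := a3.symm.trans b3
  have q2 := congrArg (fun X => X * (V * diagonal (fun i => (σ i)⁻¹) * Vᵀ)) q
  simp only [Matrix.mul_assoc _ (V * diagonal σ * Vᵀ), a5] at q2
  rw [a6, p3, b6] at q2
  exact q2

/-- The left factor `U` of a singular value decomposition of `L`. -/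
def svdLeft {n m : ℕ} (L : Matrix (Fin n) (Fin m) ℝ) : Matrix (Fin n) (Fin L.rank) ℝ :=
  (exists_isSVD L).choose

/-- The right factor `V` of the same singular value decomposition of `L`. -/
def svdRight {n m : ℕ} (L : Matrix (Fin n) (Fin m) ℝ) : Matrix (Fin m) (Fin L.rank) ℝ :=
  (exists_isSVD L).choose_spec.choose_spec.choose

/-- Joint incoherence `(n m / rank L) max_{k,l} |⟨e_k, U Vᵀ e_l⟩|²`, where `L = U Σ Vᵀ` is a
singular value decomposition; by `IsSVD.mul_transpose_unique` its choice is immaterial. -/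
def jointIncoherence {n m : ℕ} (L : Matrix (Fin n) (Fin m) ℝ) : ℝ :=
  ((n : ℝ) * (m : ℝ) / (L.rank : ℝ)) *
    ⨆ kl : Fin n × Fin m, |(svdLeft L * (svdRight L)ᵀ) kl.1 kl.2| ^ 2

end

end GaussianLoadings

open GaussianLoadings

/-! The left bound is deterministic. The range of `L = r^{-1/2} S Gᵀ` lies in that of `S`, so the
projection of `e_k` is some `S v` with `‖S v‖² = (S v)_k`. Cauchy–Schwarz against row `k` of `S`, of
squared length `r`, gives `(S v)_k² ≤ r ‖v‖²`, while the permeance gives `n ν ‖v‖² ≤ ‖S v‖²`. Hence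
`(S v)_k ≤ r / (n ν)` (`leverage_le`).

The two tail bounds are read off the polar factor `F(G) = U Vᵀ` of `L`. For orthogonal `Q` one has
`F(Q G) = F(G) Qᵀ`, and `Q G` has the law of `G`. So in the law of a quadratic function of `F(G)
e_l`, the vector `e_l` may be replaced by `h / ‖h‖` with `h` standard normal and independent of `G`
(`measure_polarFactor_single_le`). Now fix `G`. Then `‖F h‖² = ‖Vᵀ h‖²` is a projection of `h` onto
`r` dimensions, and `(F h)_k` is the product of `h` with row `k` of `F`, whose squared length is at
most `r / (n ν)` by the leverage bound again.

Both reduce to one estimate: a projection onto `d` of `m` dimensions carries a share of at least `d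
t / m` of `‖h‖²` with probability at most `2 exp (-t / 2)`, for `t ≥ 2`
(`measure_orthonormal_projection_le`). With `t = 4 (α + 1) log (n + m)` one has `exp (-t / 2) ≤ (n
m)^{-α-1}`, and a union bound over `m` columns or `n m` entries concludes. -/

/-! ### Exponential moments and tails of chi-squared variables -/

theorem integral_exp_mul_sq_gaussianReal {θ : ℝ} (hθ : θ < 1 / 2) :
    ∫ x, Real.exp (θ * x ^ 2) ∂(gaussianReal 0 1) = (√(1 - 2 * θ))⁻¹ := by
  rw [integral_gaussianReal_eq_integral_smul one_ne_zero]
  have h : ∀ x : ℝ, gaussianPDFReal 0 1 x • Real.exp (θ * x ^ 2)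
      = (√(2 * Real.pi))⁻¹ * Real.exp (-(1 / 2 - θ) * x ^ 2) := by
    intro x
    simp only [gaussianPDFReal, smul_eq_mul, NNReal.coe_one, mul_one, sub_zero]
    rw [mul_assoc, ← Real.exp_add]
    congr 2
    ring
  simp_rw [h]
  have h2 : (0 : ℝ) < 1 - 2 * θ := by linarith
  rw [integral_const_mul, integral_gaussian,
    show Real.pi / (1 / 2 - θ) = (2 * Real.pi) / (1 - 2 * θ) by
      rw [div_eq_div_iff (by linarith) h2.ne']; ring,
    Real.sqrt_div (by positivity), ← mul_div_assoc, inv_mul_cancel₀ (by positivity), one_div]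

theorem integral_exp_mul_sum_sq_pi_gaussianReal {ι : Type*} [Fintype ι] {θ : ℝ}
    (hθ : θ < 1 / 2) :
    ∫ x : ι → ℝ, Real.exp (θ * ∑ i, x i ^ 2) ∂(Measure.pi fun _ => gaussianReal 0 1)
      = (√(1 - 2 * θ))⁻¹ ^ Fintype.card ι := by
  simp_rw [Finset.mul_sum, Real.exp_sum]
  rw [integral_fintype_prod_eq_prod (fun (_ : ι) (x : ℝ) => Real.exp (θ * x ^ 2))]
  simp [integral_exp_mul_sq_gaussianReal hθ]

theorem integrable_exp_mul_sum_sq_pi_gaussianReal {ι : Type*} [Fintype ι] {θ : ℝ}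
    (hθ : θ < 1 / 2) :
    Integrable (fun x : ι → ℝ => Real.exp (θ * ∑ i, x i ^ 2))
      (Measure.pi fun _ => gaussianReal 0 1) := by
  refine Integrable.of_integral_ne_zero ?_
  rw [integral_exp_mul_sum_sq_pi_gaussianReal hθ]
  have : (0 : ℝ) < 1 - 2 * θ := by linarith
  positivity

/-- Chernoff bound for the chi-squared tail. -/
theorem measure_le_sum_sq_pi_gaussianReal {ι : Type*} [Fintype ι] {θ : ℝ} (h0 : 0 ≤ θ)
    (hθ : θ < 1 / 2) (y : ℝ) :
    (Measure.pi fun _ : ι => gaussianReal 0 1) {x | y ≤ ∑ i, x i ^ 2}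
      ≤ ENNReal.ofReal ((√(1 - 2 * θ))⁻¹ ^ Fintype.card ι * Real.exp (-θ * y)) := by
  have h := measure_ge_le_exp_mul_mgf (μ := Measure.pi fun _ : ι => gaussianReal 0 1)
    (X := fun x : ι → ℝ => ∑ i, x i ^ 2) y h0 (integrable_exp_mul_sum_sq_pi_gaussianReal hθ)
  rw [mgf, integral_exp_mul_sum_sq_pi_gaussianReal hθ] at h
  rw [← ofReal_measureReal]
  exact ENNReal.ofReal_le_ofReal (by linarith)

/-- Chernoff for `x` rather than `x²`, on both sides, reaches the endpoint rate `1 / 2`, where the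
exponential moment of `x²` is infinite. One degree of freedom needs this rate. -/
theorem measure_le_sq_gaussianReal {y : ℝ} (hy : 0 ≤ y) :
    gaussianReal 0 1 {x | y ≤ x ^ 2} ≤ ENNReal.ofReal (2 * Real.exp (-(1 / 2) * y)) := by
  have one : ∀ s : ℝ, 0 ≤ s → gaussianReal 0 1 {x | s ≤ x}
      ≤ ENNReal.ofReal (Real.exp (-(s ^ 2) / 2)) := by
    intro s hs
    have h := measure_ge_le_exp_mul_mgf (μ := gaussianReal 0 1) (X := id) s hs
      (integrable_exp_mul_gaussianReal s)
    rw [mgf_id_gaussianReal, ← Real.exp_add] at h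
    rw [← ofReal_measureReal]
    refine ENNReal.ofReal_le_ofReal (h.trans (Real.exp_le_exp.2 (le_of_eq ?_)))
    simp; ring
  have two : gaussianReal 0 1 {x | x ≤ -√y} ≤ ENNReal.ofReal (Real.exp (-(√y ^ 2) / 2)) := by
    have h := gaussianReal_map_neg (μ := 0) (v := 1)
    rw [neg_zero] at h
    rw [← h, Measure.map_apply (by fun_prop) (show MeasurableSet {x | x ≤ -√y} from measurableSet_Iic)]
    have e : (fun x : ℝ => -x) ⁻¹' {x | x ≤ -√y} = {x | √y ≤ x} := by ext; simp
    rw [e]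
    exact one _ (Real.sqrt_nonneg _)
  have sub : {x : ℝ | y ≤ x ^ 2} ⊆ {x | √y ≤ x} ∪ {x | x ≤ -√y} := by
    intro x hx
    have := Real.abs_le_sqrt (x := √y) (y := x ^ 2) (by rwa [Real.sq_sqrt hy])
    rw [Real.sqrt_sq_eq_abs, abs_of_nonneg (Real.sqrt_nonneg _)] at this
    rcases le_abs.1 this with h | h
    · exact Or.inl h
    · exact Or.inr (by show x ≤ -√y; linarith)
  calc _ ≤ _ := measure_mono sub
    _ ≤ _ := measure_union_le _ _
    _ ≤ _ := add_le_add (one _ (Real.sqrt_nonneg _)) two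
    _ = _ := by
      rw [← ENNReal.ofReal_add (by positivity) (by positivity), Real.sq_sqrt hy, ← two_mul]
      congr 3; ring

/-! ### Ratios of independent chi-squared variables -/

/-- Conditioning on `Y` and inserting its value into the tail of `X` turns the probability into a
Laplace transform of `Y`. -/
theorem measure_prod_le_of_exp_tail {α β : Type*} [MeasurableSpace α] [MeasurableSpace β]
    {μ : Measure α} {ν : Measure β} [SFinite μ] [SFinite ν] {X : α → ℝ} {Y : β → ℝ}
    (hX : Measurable X) (hY : Measurable Y) (hY0 : ∀ b, 0 ≤ Y b) {K s : ℝ} (hK : 0 ≤ K)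
    (hint : Integrable (fun b => Real.exp (-s * Y b)) ν)
    (htail : ∀ y, 0 ≤ y → μ {a | y ≤ X a} ≤ ENNReal.ofReal (K * Real.exp (-s * y))) :
    (μ.prod ν) {p | Y p.2 ≤ X p.1} ≤ ENNReal.ofReal (K * ∫ b, Real.exp (-s * Y b) ∂ν) := by
  have hs : MeasurableSet {p : α × β | Y p.2 ≤ X p.1} :=
    measurableSet_le (hY.comp measurable_snd) (hX.comp measurable_fst)
  rw [Measure.prod_apply_symm hs,
    ← integral_const_mul, ofReal_integral_eq_lintegral_ofReal (hint.const_mul K)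
      (Filter.Eventually.of_forall fun b => by positivity)]
  exact lintegral_mono fun b => htail _ (hY0 b)

/-- By `1 - x ≤ exp (-x)` the left side is at most `(t exp (1 - t))^{r/2}`. The base is at most `1`,
so the worst case is `r = 2`, where `t / 2 ≤ exp (t / 2 - 1)` suffices. -/
theorem sqrt_pow_mul_sqrt_pow_le {r k : ℕ} (hr : 2 ≤ r) {t : ℝ} (ht : 2 ≤ t)
    (hlt : (r : ℝ) * t < r + k) :
    √t ^ r * √(1 - r * (t - 1) / k) ^ k ≤ 2 * Real.exp (-t / 2) := by
  have hr' : (2 : ℝ) ≤ r := by exact_mod_cast hr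
  have hk : (0 : ℝ) < k := by nlinarith
  have h1 : √(1 - r * (t - 1) / k) ^ k ≤ Real.exp (-(t - 1) / 2) ^ r := by
    have : √(1 - r * (t - 1) / k) ≤ Real.exp (-(r * (t - 1) / k) / 2) := by
      rw [Real.exp_half]
      exact Real.sqrt_le_sqrt (Real.one_sub_le_exp_neg _)
    refine (pow_le_pow_left₀ (Real.sqrt_nonneg _) this k).trans (le_of_eq ?_)
    rw [← Real.exp_nat_mul, ← Real.exp_nat_mul]
    congr 1
    field_simp
  have h2 : √t * Real.exp (-(t - 1) / 2) ≤ 1 := by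
    have : √t ≤ Real.exp ((t - 1) / 2) := by
      rw [Real.exp_half]
      exact Real.sqrt_le_sqrt (by linarith [Real.add_one_le_exp (t - 1)])
    calc _ ≤ Real.exp ((t - 1) / 2) * Real.exp (-(t - 1) / 2) := by gcongr
      _ = 1 := by rw [← Real.exp_add, ← Real.exp_zero]; congr 1; ring
  calc _ ≤ √t ^ r * Real.exp (-(t - 1) / 2) ^ r := by gcongr
    _ = (√t * Real.exp (-(t - 1) / 2)) ^ r := (mul_pow _ _ _).symm
    _ ≤ (√t * Real.exp (-(t - 1) / 2)) ^ 2 := pow_le_pow_of_le_one (by positivity) h2 hr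
    _ = t * (Real.exp (1 - t / 2) * Real.exp (-t / 2)) := by
      rw [mul_pow, Real.sq_sqrt (by linarith), ← Real.exp_nat_mul, ← Real.exp_add]
      congr 2; push_cast; ring
    _ ≤ 2 * Real.exp (-t / 2) := by
      rw [← mul_assoc]
      gcongr
      have h3 : t / 2 ≤ Real.exp (t / 2 - 1) := by linarith [Real.add_one_le_exp (t / 2 - 1)]
      calc t * Real.exp (1 - t / 2) = 2 * (t / 2 * Real.exp (1 - t / 2)) := by ring
        _ ≤ 2 * (Real.exp (t / 2 - 1) * Real.exp (1 - t / 2)) := by gcongr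
        _ = 2 := by rw [← Real.exp_add]; simp

/-- With `c = t / (1 + k - t)`, the bound `log (1 + c) ≥ 2 c / (c + 2)` reduces the claim to `t / 2
≤ k t / (2 + 2 k - t)`, which is exactly where `t ≥ 2` enters. -/
theorem inv_sqrt_one_add_pow_le {k : ℕ} {t : ℝ} (ht : 2 ≤ t) (hlt : t < 1 + k) :
    (√(1 + t / (1 + k - t)))⁻¹ ^ k ≤ Real.exp (-t / 2) := by
  have hd : 0 < 1 + k - t := by linarith
  set c := t / (1 + k - t) with hc
  have hc0 : 0 ≤ c := by positivity
  have h1 : Real.exp (c / (c + 2)) ≤ √(1 + c) := by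
    have := Real.le_log_one_add_of_nonneg hc0
    have h : Real.exp (2 * c / (c + 2)) ≤ 1 + c := (Real.le_log_iff_exp_le (by linarith)).1 this
    rw [show c / (c + 2) = (2 * c / (c + 2)) / 2 by ring, Real.exp_half]
    exact Real.sqrt_le_sqrt h
  have h2 : t / 2 ≤ k * (c / (c + 2)) := by
    have e : c / (c + 2) = t / (2 + 2 * k - t) := by
      rw [hc]
      rw [div_eq_div_iff (by positivity) (by linarith)]
      field_simp
      ring
    rw [e, ← mul_div_assoc, div_le_div_iff₀ (by norm_num) (by linarith)]
    nlinarith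
  rw [inv_pow, neg_div, Real.exp_neg]
  refine inv_anti₀ (Real.exp_pos _) ?_
  calc Real.exp (t / 2) ≤ Real.exp (k * (c / (c + 2))) := Real.exp_le_exp.2 h2
    _ = Real.exp (c / (c + 2)) ^ k := Real.exp_nat_mul _ _
    _ ≤ _ := pow_le_pow_left₀ (Real.exp_pos _).le h1 k

theorem measure_eq_zero_pi_gaussianReal {ι : Type*} [Fintype ι] (i : ι) :
    (Measure.pi fun _ : ι => gaussianReal 0 1) {x | x i = 0} = 0 := by
  have : NullSingletonClass (gaussianReal 0 1) := nullSingletonClass_gaussianReal one_ne_zero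
  have h := (measurePreserving_eval (fun _ : ι => gaussianReal 0 1) i).measure_preimage
    (measurableSet_singleton (0 : ℝ)).nullMeasurableSet
  rw [measure_singleton] at h
  exact h

/-- Tail bound for the ratio of a chi-squared variable with `r` degrees of freedom and the sum
of it with an independent chi-squared variable with `k` degrees of freedom. -/
theorem measure_prod_chiSq_ratio_le {κ κ' : Type*} [Fintype κ] [Fintype κ'] [Nonempty κ] {t : ℝ}
    (ht : 2 ≤ t) :
    ((Measure.pi fun _ : κ => gaussianReal 0 1).prod (Measure.pi fun _ : κ' => gaussianReal 0 1))
      {p | (Fintype.card κ : ℝ) * t / (Fintype.card κ + Fintype.card κ')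
        * (∑ i, p.1 i ^ 2 + ∑ i, p.2 i ^ 2) ≤ ∑ i, p.1 i ^ 2}
      ≤ ENNReal.ofReal (2 * Real.exp (-t / 2)) := by
  obtain ⟨i₀⟩ := ‹Nonempty κ›
  have hr : 0 < Fintype.card κ := Fintype.card_pos_iff.2 ⟨i₀⟩
  set r := Fintype.card κ with hrdef
  set k := Fintype.card κ' with hkdef
  have hr' : (0 : ℝ) < r := by exact_mod_cast hr
  have hk' : (0 : ℝ) ≤ k := k.cast_nonneg
  have hA : ∀ x : κ → ℝ, 0 ≤ ∑ i, x i ^ 2 := fun x => Finset.sum_nonneg fun i _ => sq_nonneg _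
  have hB : ∀ x : κ' → ℝ, 0 ≤ ∑ i, x i ^ 2 := fun x => Finset.sum_nonneg fun i _ => sq_nonneg _
  have mA : Measurable fun x : κ → ℝ => ∑ i, x i ^ 2 := by fun_prop
  have mB : Measurable fun x : κ' → ℝ => ∑ i, x i ^ 2 := by fun_prop
  rcases lt_or_ge ((r : ℝ) * t) (r + k) with hlt | hge
  · have hd : 0 < r + k - r * t := by linarith
    have hc : 0 ≤ r * t / (r + k - r * t) := by positivity
    have hset : {p : (κ → ℝ) × (κ' → ℝ) | (r : ℝ) * t / (r + k)
        * (∑ i, p.1 i ^ 2 + ∑ i, p.2 i ^ 2) ≤ ∑ i, p.1 i ^ 2}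
        = {p | r * t / (r + k - r * t) * ∑ i, p.2 i ^ 2 ≤ ∑ i, p.1 i ^ 2} := by
      ext p
      show (_ : ℝ) ≤ _ ↔ (_ : ℝ) ≤ _
      rw [div_mul_eq_mul_div, div_mul_eq_mul_div, div_le_iff₀ (by linarith), div_le_iff₀ hd]
      constructor <;> intro h <;> linarith
    rw [hset]
    have main : ∀ {K s : ℝ}, 0 ≤ K → 0 ≤ s →
        (∀ y, 0 ≤ y → (Measure.pi fun _ : κ => gaussianReal 0 1) {x | y ≤ ∑ i, x i ^ 2}
          ≤ ENNReal.ofReal (K * Real.exp (-s * y))) →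
        K * (√(1 + 2 * (s * (r * t / (r + k - r * t)))))⁻¹ ^ k ≤ 2 * Real.exp (-t / 2) →
        ((Measure.pi fun _ : κ => gaussianReal 0 1).prod
          (Measure.pi fun _ : κ' => gaussianReal 0 1))
          {p | r * t / (r + k - r * t) * ∑ i, p.2 i ^ 2 ≤ ∑ i, p.1 i ^ 2}
          ≤ ENNReal.ofReal (2 * Real.exp (-t / 2)) := by
      intro K s hK hs htail hle
      have hθ : -(s * (r * t / (r + k - r * t))) < 1 / 2 := by
        have : 0 ≤ s * (r * t / (r + k - r * t)) := by positivity
        linarith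
      have e : ∀ b : κ' → ℝ, Real.exp (-s * (r * t / (r + k - r * t) * ∑ i, b i ^ 2))
          = Real.exp (-(s * (r * t / (r + k - r * t))) * ∑ i, b i ^ 2) := fun b => by
        congr 1; ring
      refine (measure_prod_le_of_exp_tail mA (mB.const_mul _)
        (fun b => mul_nonneg hc (hB b)) hK ?_ htail).trans (ENNReal.ofReal_le_ofReal ?_)
      · simp_rw [e]
        exact integrable_exp_mul_sum_sq_pi_gaussianReal hθ
      · simp_rw [e]
        rw [integral_exp_mul_sum_sq_pi_gaussianReal hθ]
        simpa only [mul_neg, sub_neg_eq_add, ← hkdef] using hle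
    -- For `r = 1` the Chernoff bound for `x²` would leave a factor of order `√t`; the Gaussian tail
    -- with `K = 2`, `s = 1 / 2` avoids it.
    rcases Nat.lt_or_ge r 2 with h1 | h2
    · have hr1 : r = 1 := by omega
      rw [hr1] at hrdef
      have : Unique κ := @Unique.mk' κ ⟨i₀⟩ (Fintype.card_le_one_iff_subsingleton.1 hrdef.ge)
      refine main (K := 2) (s := 1 / 2) (by norm_num) (by norm_num) ?_ ?_
      · intro y hy
        have h := (measurePreserving_eval (fun _ : κ => gaussianReal 0 1) default).measure_preimage
          (s := {x : ℝ | y ≤ x ^ 2})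
          (measurableSet_le measurable_const (measurable_id.pow_const 2)).nullMeasurableSet
        refine le_trans (le_of_eq ?_) (measure_le_sq_gaussianReal hy)
        rw [← h]
        congr 1
        ext x
        simp
      · rw [hr1] at hlt ⊢
        simp only [Nat.cast_one, one_mul] at hlt ⊢
        have := inv_sqrt_one_add_pow_le ht hlt
        rw [← mul_assoc, mul_one_div_cancel two_ne_zero, one_mul]
        gcongr
    · have hk0 : (0 : ℝ) < k := by nlinarith
      have hs : 1 - 2 * ((1 - 1 / t) / 2) = 1 / t := by ring
      have ht1 : 1 / t ≤ 1 / 2 := one_div_le_one_div_of_le (by norm_num) ht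
      have ht0 : 0 < 1 / t := by positivity
      -- This `s` minimises the resulting bound; it makes `1 - 2 s = 1 / t`.
      refine main (K := √t ^ r) (s := (1 - 1 / t) / 2) (by positivity) (by linarith) ?_ ?_
      · intro y _
        have := measure_le_sum_sq_pi_gaussianReal (ι := κ) (θ := (1 - 1 / t) / 2)
          (by linarith) (by linarith) y
        rwa [hs, Real.sqrt_div zero_le_one, Real.sqrt_one, inv_div, div_one, ← hrdef] at this
      · have e : (1 + 2 * ((1 - 1 / t) / 2 * (r * t / (r + k - r * t))))
            = (1 - r * (t - 1) / k)⁻¹ := by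
          rw [one_sub_div hk0.ne', inv_div, show (k : ℝ) - r * (t - 1) = r + k - r * t by ring]
          obtain ⟨D, hD⟩ : ∃ D, D = r + k - r * t := ⟨_, rfl⟩
          rw [← hD] at hd ⊢
          field_simp
          rw [hD]
          ring
        rw [e, Real.sqrt_inv, inv_inv]
        exact sqrt_pow_mul_sqrt_pow_le h2 ht hlt
  -- The required share is at least `1`, so the second sum must vanish, a null event. If there are
  -- no second coordinates, the share is `t ≥ 2` and the first sum must vanish instead.
  · have hρ : 1 ≤ r * t / (r + k) := (one_le_div (by linarith)).2 hge
    refine le_trans (le_of_eq ?_) zero_le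
    rcases isEmpty_or_nonempty κ' with hE | ⟨⟨j₀⟩⟩
    · have hk0 : k = 0 := Fintype.card_eq_zero
      refine measure_mono_null (t := {x : κ → ℝ | x i₀ = 0} ×ˢ Set.univ) ?_ ?_
      · rintro p hp
        refine ⟨?_, trivial⟩
        have hp' : (r : ℝ) * t / (r + k) * (∑ i, p.1 i ^ 2 + ∑ i, p.2 i ^ 2) ≤ ∑ i, p.1 i ^ 2 := hp
        rw [hk0, Nat.cast_zero, add_zero, mul_div_cancel_left₀ _ hr'.ne',
          Finset.univ_eq_empty (α := κ'), Finset.sum_empty, add_zero] at hp'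
        have h0 : ∑ i, p.1 i ^ 2 = 0 := le_antisymm (by nlinarith [hA p.1]) (hA p.1)
        have := (Finset.sum_eq_zero_iff_of_nonneg fun i _ => sq_nonneg _).1 h0 i₀
          (Finset.mem_univ _)
        exact pow_eq_zero_iff two_ne_zero |>.1 this
      · rw [Measure.prod_prod, measure_eq_zero_pi_gaussianReal, zero_mul]
    · refine measure_mono_null (t := Set.univ ×ˢ {x : κ' → ℝ | x j₀ = 0}) ?_ ?_
      · rintro p hp
        refine ⟨trivial, ?_⟩
        have hp' : (r : ℝ) * t / (r + k) * (∑ i, p.1 i ^ 2 + ∑ i, p.2 i ^ 2) ≤ ∑ i, p.1 i ^ 2 := hp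
        have h0 : ∑ i, p.2 i ^ 2 = 0 := le_antisymm (by nlinarith [hA p.1, hB p.2]) (hB p.2)
        have := (Finset.sum_eq_zero_iff_of_nonneg fun i _ => sq_nonneg _).1 h0 j₀
          (Finset.mem_univ _)
        exact pow_eq_zero_iff two_ne_zero |>.1 this
      · rw [Measure.prod_prod, measure_eq_zero_pi_gaussianReal, mul_zero]

theorem measure_chiSq_ratio_le {ι : Type*} [Fintype ι] (p : ι → Prop) [DecidablePred p]
    [Nonempty {i // p i}] {t : ℝ} (ht : 2 ≤ t) :
    (Measure.pi fun _ : ι => gaussianReal 0 1)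
      {x | (Fintype.card {i // p i} : ℝ) * t / Fintype.card ι * ∑ i, x i ^ 2
        ≤ ∑ i : {i // p i}, x i ^ 2} ≤ ENNReal.ofReal (2 * Real.exp (-t / 2)) := by
  have hcard : (Fintype.card ι : ℝ) = Fintype.card {i // p i} + Fintype.card {i // ¬ p i} := by
    rw [← Nat.cast_add, ← Fintype.card_sum, Fintype.card_congr (Equiv.sumCompl p)]
  have hpre := measurePreserving_piEquivPiSubtypeProd (fun _ : ι => gaussianReal 0 1) p
  refine le_trans (le_of_eq ?_)
    (measure_prod_chiSq_ratio_le (κ := {i // p i}) (κ' := {i // ¬ p i}) ht)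
  rw [← hpre.measure_preimage_equiv]
  congr 1
  ext x
  show (_ : ℝ) ≤ _ ↔ (_ : ℝ) ≤ _
  rw [hcard, ← Fintype.sum_subtype_add_sum_subtype p]
  rfl

/-! ### Orthogonal invariance and projections of normal vectors -/

theorem measurePreserving_pi_gaussianReal_of_isometry {ι : Type*} [Fintype ι]
    (f : EuclideanSpace ℝ ι ≃ₗᵢ[ℝ] EuclideanSpace ℝ ι) :
    MeasurePreserving (fun x : ι → ℝ => (f (WithLp.toLp 2 x)).ofLp)
      (Measure.pi fun _ => gaussianReal 0 1) (Measure.pi fun _ => gaussianReal 0 1) := by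
  have m1 : Measurable (WithLp.toLp 2 : (ι → ℝ) → EuclideanSpace ℝ ι) := by fun_prop
  have m2 : Measurable (WithLp.ofLp : EuclideanSpace ℝ ι → ι → ℝ) := by fun_prop
  have m3 : Measurable f := f.continuous.measurable
  have e : (stdGaussian (EuclideanSpace ℝ ι)).map WithLp.ofLp
      = Measure.pi fun _ : ι => gaussianReal 0 1 := by
    rw [← map_pi_eq_stdGaussian, Measure.map_map m2 m1]
    exact Measure.map_id
  refine ⟨m2.comp (m3.comp m1), ?_⟩
  rw [show (fun x : ι → ℝ => (f (WithLp.toLp 2 x)).ofLp)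
      = WithLp.ofLp ∘ (f ∘ WithLp.toLp 2) from rfl, ← Measure.map_map m2 (m3.comp m1),
    ← Measure.map_map m3 m1, map_pi_eq_stdGaussian, stdGaussian_map, e]

theorem dotProduct_mulVec_mulVec_of_orthogonal {m r : ℕ} {Q : Matrix (Fin m) (Fin r) ℝ}
    (hQ : Qᵀ * Q = 1) (x : Fin r → ℝ) : Q *ᵥ x ⬝ᵥ Q *ᵥ x = x ⬝ᵥ x := by
  rw [Matrix.dotProduct_mulVec, Matrix.vecMul_mulVec, hQ, Matrix.vecMul_one]

theorem norm_toLp_sq {ι : Type*} [Fintype ι] (x : ι → ℝ) :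
    ‖(WithLp.toLp 2 x : EuclideanSpace ℝ ι)‖ ^ 2 = x ⬝ᵥ x := by
  rw [EuclideanSpace.real_norm_sq_eq]
  simp [dotProduct, sq]

theorem measurePreserving_mulVec {m : ℕ} {Q : Matrix (Fin m) (Fin m) ℝ} (hQ : Qᵀ * Q = 1) :
    MeasurePreserving (fun x : Fin m → ℝ => Q *ᵥ x)
      (Measure.pi fun _ => gaussianReal 0 1) (Measure.pi fun _ => gaussianReal 0 1) := by
  let f : EuclideanSpace ℝ (Fin m) →ₗᵢ[ℝ] EuclideanSpace ℝ (Fin m) :=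
    ⟨Matrix.toEuclideanLin Q, fun x => by
      rw [← sq_eq_sq₀ (norm_nonneg _) (norm_nonneg _)]
      have h := dotProduct_mulVec_mulVec_of_orthogonal hQ x.ofLp
      rw [← norm_toLp_sq, ← norm_toLp_sq] at h
      exact h⟩
  exact measurePreserving_pi_gaussianReal_of_isometry (f.toLinearIsometryEquiv rfl)

instance isProbabilityMeasure_stdNormalMatrix (m r : ℕ) :
    IsProbabilityMeasure (stdNormalMatrix m r) := by
  unfold stdNormalMatrix
  exact inferInstanceAs (IsProbabilityMeasure
    (Measure.pi fun _ : Fin m => Measure.pi fun _ : Fin r => gaussianReal 0 1))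

theorem measurePreserving_transpose (m r : ℕ) :
    MeasurePreserving (Matrix.transpose : Matrix (Fin m) (Fin r) ℝ → Matrix (Fin r) (Fin m) ℝ)
      (stdNormalMatrix m r) (stdNormalMatrix r m) := by
  have c : ∀ a b : ℕ, MeasurePreserving (MeasurableEquiv.curry (Fin a) (Fin b) ℝ)
      (Measure.pi fun _ => gaussianReal 0 1)
      (Measure.pi fun _ : Fin a => Measure.pi fun _ : Fin b => gaussianReal 0 1) := by
    intro a b
    refine ⟨MeasurableEquiv.measurable _, ?_⟩
    have := Measure.infinitePi_map_curry (fun (_ : Fin a) (_ : Fin b) => gaussianReal 0 1)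
    simpa only [Measure.infinitePi_eq_pi] using this
  have h := ((c r m).comp ((measurePreserving_arrowCongr' (fun _ => gaussianReal 0 1)
    (fun _ => gaussianReal 0 1) (Equiv.prodComm (Fin m) (Fin r)) (MeasurableEquiv.refl ℝ)
    (fun _ => MeasurePreserving.id _)))).comp ((c m r).symm)
  exact h

/-- `Q` acts on columns, but `stdNormalMatrix` is a product over rows. Transposition makes the
columns the independent factors, each rotated by `Q`. -/
theorem measurePreserving_mul_left {m : ℕ} (r : ℕ) {Q : Matrix (Fin m) (Fin m) ℝ}
    (hQ : Qᵀ * Q = 1) :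
    MeasurePreserving (fun G : Matrix (Fin m) (Fin r) ℝ => Q * G)
      (stdNormalMatrix m r) (stdNormalMatrix m r) := by
  have h : MeasurePreserving (fun (G : Matrix (Fin r) (Fin m) ℝ) i => Q *ᵥ G i)
      (stdNormalMatrix r m) (stdNormalMatrix r m) :=
    measurePreserving_pi _ _ fun _ => measurePreserving_mulVec hQ
  have h2 := (measurePreserving_transpose r m).comp (h.comp (measurePreserving_transpose m r))
  have e : (fun G : Matrix (Fin m) (Fin r) ℝ => Q * G)
      = Matrix.transpose ∘ (fun (G : Matrix (Fin r) (Fin m) ℝ) i => Q *ᵥ G i) ∘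
        Matrix.transpose := by
    ext G i j
    rfl
  rw [e]
  exact h2

/-- The Householder reflection in the hyperplane orthogonal to `w = h - ‖h‖ e_l` exchanges the two
vectors of equal length `h` and `‖h‖ e_l`. -/
theorem exists_orthogonal_mulVec_eq {m : ℕ} (h : Fin m → ℝ) (l : Fin m) :
    ∃ Q : Matrix (Fin m) (Fin m) ℝ, Qᵀ * Q = 1 ∧ Q *ᵥ h = √(h ⬝ᵥ h) • Pi.single l 1 := by
  set c := √(h ⬝ᵥ h) with hc
  set w := h - c • Pi.single l (1 : ℝ) with hw
  have hc2 : c * c = h ⬝ᵥ h := Real.mul_self_sqrt (Finset.sum_nonneg fun i _ => mul_self_nonneg (h i))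
  by_cases hw0 : w = 0
  · exact ⟨1, by simp, by rw [Matrix.one_mulVec]; exact sub_eq_zero.1 hw0⟩
  have hww : w ⬝ᵥ w ≠ 0 := fun h0 => hw0 (dotProduct_self_eq_zero.1 h0)
  have h2 : 2 * (w ⬝ᵥ h) = w ⬝ᵥ w := by
    have e1 : w ⬝ᵥ h = h ⬝ᵥ h - c * h l := by
      simp [hw, sub_dotProduct]
    have e2 : w ⬝ᵥ w = h ⬝ᵥ h - 2 * (c * h l) + c * c := by
      simp [hw, sub_dotProduct, dotProduct_sub]
      ring
    rw [e1, e2, hc2]; ring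
  refine ⟨1 - (2 / (w ⬝ᵥ w)) • vecMulVec w w, ?_, ?_⟩
  · have ht : (vecMulVec w w)ᵀ = vecMulVec w w := by
      ext i j; simp [vecMulVec_apply, mul_comm]
    have hs : vecMulVec w w * vecMulVec w w = (w ⬝ᵥ w) • vecMulVec w w := by
      rw [vecMulVec_mul_vecMulVec]
      ext i j; simp [vecMulVec_apply]; ring
    rw [Matrix.transpose_sub, Matrix.transpose_one, Matrix.transpose_smul, ht, Matrix.sub_mul,
      Matrix.mul_sub, Matrix.mul_sub]
    simp only [Matrix.one_mul, Matrix.mul_one, Matrix.smul_mul, Matrix.mul_smul, hs, smul_smul]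
    rw [div_mul_cancel₀ _ hww, sub_sub, ← add_sub_assoc, ← add_smul, ← sub_smul]
    have : 2 / (w ⬝ᵥ w) + 2 / (w ⬝ᵥ w) - 2 / (w ⬝ᵥ w) * 2 = 0 := by ring
    rw [this, zero_smul, sub_zero]
  · have e : vecMulVec w w *ᵥ h = (w ⬝ᵥ h) • w := by
      ext i; simp [vecMulVec_mulVec, mul_comm]
    rw [Matrix.sub_mulVec, Matrix.one_mulVec, Matrix.smul_mulVec, e, smul_smul,
      div_mul_eq_mul_div, h2, div_self hww, one_smul, hw, sub_sub_cancel]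

/-- Tail bound for the relative length of the projection of a standard normal vector onto the span
of `r` orthonormal vectors. -/
theorem measure_orthonormal_projection_le {m r : ℕ} (hr : 0 < r) (hrm : r ≤ m)
    {V : Matrix (Fin m) (Fin r) ℝ} (hV : Vᵀ * V = 1) {t : ℝ} (ht : 2 ≤ t) :
    (Measure.pi fun _ : Fin m => gaussianReal 0 1)
      {h | (r : ℝ) * t / m * (h ⬝ᵥ h) ≤ Vᵀ *ᵥ h ⬝ᵥ Vᵀ *ᵥ h}
      ≤ ENNReal.ofReal (2 * Real.exp (-t / 2)) := by
  -- The columns of `V` are padded by zeros to a family indexed by `Fin m`, so that they extend to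
  -- an orthonormal basis whose first `r` coordinates are those of `Vᵀ h`.
  let v : Fin m → EuclideanSpace ℝ (Fin m) := fun i =>
    if hi : (i : ℕ) < r then WithLp.toLp 2 (fun a => V a ⟨i, hi⟩) else 0
  have hv : Orthonormal ℝ (({i : Fin m | (i : ℕ) < r}).domRestrict v) := by
    rw [orthonormal_iff_ite]
    rintro ⟨i, hi⟩ ⟨j, hj⟩
    have hi' : (i : ℕ) < r := hi
    have hj' : (j : ℕ) < r := hj
    have h : (Vᵀ * V) ⟨j, hj'⟩ ⟨i, hi'⟩ = (1 : Matrix (Fin r) (Fin r) ℝ) ⟨j, hj'⟩ ⟨i, hi'⟩ := by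
      rw [hV]
    rw [Matrix.mul_apply, Matrix.one_apply] at h
    simp only [Set.domRestrict_apply, v, hi', hj', dif_pos, PiLp.inner_apply]
    simp only [Matrix.transpose_apply] at h
    simp only [RCLike.inner_apply, conj_trivial]
    rw [h]
    simp [Fin.ext_iff, eq_comm]
  obtain ⟨b, hb⟩ := hv.exists_orthonormalBasis_extension_of_card_eq (by simp)
  have : Nonempty {i : Fin m // (i : ℕ) < r} := ⟨⟨⟨0, by omega⟩, hr⟩⟩
  let e : {i : Fin m // (i : ℕ) < r} ≃ Fin r :=
    { toFun := fun i => ⟨i.1, i.2⟩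
      invFun := fun i => ⟨⟨i, by omega⟩, i.2⟩
      left_inv := fun i => rfl
      right_inv := fun i => rfl }
  have hcard : Fintype.card {i : Fin m // (i : ℕ) < r} = r := by
    rw [Fintype.card_congr e, Fintype.card_fin]
  have h := measure_chiSq_ratio_le (fun i : Fin m => (i : ℕ) < r) ht
  rw [hcard, Fintype.card_fin] at h
  refine le_trans (le_of_eq ?_) h
  have mp := measurePreserving_pi_gaussianReal_of_isometry b.repr
  have hs : MeasurableSet {x : Fin m → ℝ | (r : ℝ) * t / m * ∑ i, x i ^ 2
      ≤ ∑ i : {i : Fin m // (i : ℕ) < r}, x i ^ 2} :=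
    measurableSet_le (by fun_prop) (by fun_prop)
  rw [← mp.measure_preimage hs.nullMeasurableSet]
  congr 1
  ext x
  have e1 : ∑ i, (b.repr (WithLp.toLp 2 x)).ofLp i ^ 2 = x ⬝ᵥ x := by
    rw [← EuclideanSpace.real_norm_sq_eq, LinearIsometryEquiv.norm_map, norm_toLp_sq]
  have e2 : ∑ i : {i : Fin m // (i : ℕ) < r}, (b.repr (WithLp.toLp 2 x)).ofLp i ^ 2
      = Vᵀ *ᵥ x ⬝ᵥ Vᵀ *ᵥ x := by
    rw [dotProduct, ← e.sum_comp]
    refine Finset.sum_congr rfl fun i _ => ?_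
    rw [← sq, b.repr_apply_apply, hb i i.2]
    congr 1
    simp only [v, i.2, dif_pos, PiLp.inner_apply, RCLike.inner_apply, conj_trivial, mulVec,
      dotProduct, Matrix.transpose_apply]
    exact Finset.sum_congr rfl fun a _ => mul_comm _ _
  show _ ↔ (_ * ∑ i, (b.repr (WithLp.toLp 2 x)).ofLp i ^ 2 : ℝ)
    ≤ ∑ i : {i : Fin m // (i : ℕ) < r}, (b.repr (WithLp.toLp 2 x)).ofLp i ^ 2
  rw [e1, e2]
  rfl

/-! ### Almost sure full rank -/

/-- A proper subspace lies in the kernel of a nonzero functional, whose law is a nondegenerate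
Gaussian and has no atom at `0`. -/
theorem measure_submodule_pi_gaussianReal {ι : Type*} [Fintype ι] (W : Submodule ℝ (ι → ℝ))
    (hW : W ≠ ⊤) : (Measure.pi fun _ : ι => gaussianReal 0 1) W = 0 := by
  obtain ⟨f, hf0, hf⟩ := W.exists_le_ker_of_lt_top (lt_top_iff_ne_top.2 hW)
  have m1 : Measurable (WithLp.toLp 2 : (ι → ℝ) → EuclideanSpace ℝ ι) := by fun_prop
  let F : StrongDual ℝ (EuclideanSpace ℝ ι) :=
    LinearMap.toContinuousLinearMap (f ∘ₗ (WithLp.linearEquiv 2 ℝ (ι → ℝ)).toLinearMap)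
  have hF : F ≠ 0 := by
    intro h
    apply hf0
    refine LinearMap.ext fun x => ?_
    exact congrArg (fun g : StrongDual ℝ (EuclideanSpace ℝ ι) => g (WithLp.toLp 2 x)) h
  have hmap := IsGaussian.map_eq_gaussianReal (μ := stdGaussian (EuclideanSpace ℝ ι)) F
  rw [variance_dual_stdGaussian] at hmap
  have hv : (‖F‖ ^ 2).toNNReal ≠ 0 := by
    rw [Ne, Real.toNNReal_eq_zero, not_le]
    exact pow_pos (norm_pos_iff.2 hF) 2
  have := nullSingletonClass_gaussianReal (μ := (stdGaussian (EuclideanSpace ℝ ι))[F]) hv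
  have h0 := congrArg (fun μ : Measure ℝ => μ {0}) hmap
  simp only [measure_singleton] at h0
  rw [Measure.map_apply F.continuous.measurable (measurableSet_singleton 0),
    ← map_pi_eq_stdGaussian,
    Measure.map_apply m1 (F.continuous.measurable (measurableSet_singleton 0))] at h0
  exact measure_mono_null (fun x hx => hf hx) h0

/-- Induction on `r`: a further independent vector almost surely avoids the span of the earlier
ones, which is proper since there are fewer than `m` of them. Linear independence is an open
condition, which makes Tonelli applicable. -/
theorem ae_linearIndependent_pi_gaussianReal (m r : ℕ) (hrm : r ≤ m) :
    ∀ᵐ G : Fin r → Fin m → ℝ ∂(Measure.pi fun _ => Measure.pi fun _ => gaussianReal 0 1),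
      LinearIndependent ℝ G := by
  induction r with
  | zero => exact Filter.Eventually.of_forall fun G => linearIndependent_empty_type
  | succ r ih =>
    have ih := ih (by omega)
    have mp := measurePreserving_piFinSuccAbove
      (fun _ : Fin (r + 1) => Measure.pi fun _ : Fin m => gaussianReal 0 1) 0
    have hs : MeasurableSet {p : (Fin m → ℝ) × (Fin r → Fin m → ℝ) |
        LinearIndependent ℝ (Fin.cons p.1 p.2 : Fin (r + 1) → Fin m → ℝ)} := by
      have hc : Continuous fun p : (Fin m → ℝ) × (Fin r → Fin m → ℝ) =>
          (Fin.cons p.1 p.2 : Fin (r + 1) → Fin m → ℝ) := by fun_prop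
      exact (isOpen_setOfPred_linearIndependent.preimage hc).measurableSet
    have key : ∀ᵐ p ∂((Measure.pi fun _ : Fin m => gaussianReal 0 1).prod
        (Measure.pi fun _ : Fin r => Measure.pi fun _ : Fin m => gaussianReal 0 1)),
        LinearIndependent ℝ (Fin.cons p.1 p.2 : Fin (r + 1) → Fin m → ℝ) := by
      rw [ae_iff]
      refine (Measure.prod_apply_symm hs.compl).trans (lintegral_eq_zero_of_ae_eq_zero ?_)
      filter_upwards [ih] with v hv
      refine measure_mono_null (fun x hx => ?_)
        (measure_submodule_pi_gaussianReal (Submodule.span ℝ (Set.range v)) ?_)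
      · by_contra hx'
        exact hx (linearIndependent_finCons.2 ⟨hv, hx'⟩)
      · intro htop
        have h1 := finrank_range_le_card (R := ℝ) v
        rw [Set.finrank, htop, finrank_top, Module.finrank_fin_fun, Fintype.card_fin] at h1
        omega
    have := mp.quasiMeasurePreserving.ae key
    filter_upwards [this] with G hG
    have e : (Fin.cons (G 0) (fun j => G ((0 : Fin (r + 1)).succAbove j)) :
        Fin (r + 1) → Fin m → ℝ) = G := by
      simp only [Fin.zero_succAbove]
      exact Fin.cons_self_tail G
    rw [← e]
    exact hG

theorem ae_rank_stdNormalMatrix {m r : ℕ} (hrm : r ≤ m) :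
    ∀ᵐ G ∂(stdNormalMatrix m r), G.rank = r := by
  have h := (measurePreserving_transpose m r).quasiMeasurePreserving.ae
    (ae_linearIndependent_pi_gaussianReal m r hrm)
  filter_upwards [h] with G hG
  have := LinearIndependent.rank_matrix (M := Gᵀ) hG
  rwa [Matrix.rank_transpose, Fintype.card_fin] at this

/-! ### The polar factor: equivariance and measurability -/

theorem isSVD_svdLeft_svdRight {n m : ℕ} (L : Matrix (Fin n) (Fin m) ℝ) :
    ∃ σ, IsSVD L (svdLeft L) σ (svdRight L) :=
  ⟨_, (exists_isSVD L).choose_spec.choose_spec.choose_spec⟩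

theorem rank_eq_of_orthonormal_diagonal {n m ρ : ℕ} {L : Matrix (Fin n) (Fin m) ℝ}
    {U : Matrix (Fin n) (Fin ρ) ℝ} {σ : Fin ρ → ℝ} {V : Matrix (Fin m) (Fin ρ) ℝ}
    (hU : Uᵀ * U = 1) (hV : Vᵀ * V = 1) (hσ : ∀ i, 0 < σ i) (hL : L = U * diagonal σ * Vᵀ) :
    L.rank = ρ := by
  refine le_antisymm ?_ ?_
  · rw [hL]
    refine (rank_mul_le_left _ _).trans ((rank_mul_le_left _ _).trans ?_)
    simpa using rank_le_width U
  · have e : diagonal σ = Uᵀ * (L * V) := by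
      rw [hL, Matrix.mul_assoc, hV, Matrix.mul_one, ← Matrix.mul_assoc, hU, Matrix.one_mul]
    have h : (diagonal σ).rank = ρ := by
      rw [rank_diagonal]
      simp [(hσ _).ne']
    rw [e] at h
    exact h.ge.trans ((rank_mul_le_right _ _).trans (rank_mul_le_left _ _))

/-- Leaving the inner dimension `ρ` free allows a decomposition of one matrix to be reused for
another whose rank is not definitionally the same. -/
theorem svdLeft_mul_svdRight_transpose_eq {n m ρ : ℕ} {L : Matrix (Fin n) (Fin m) ℝ}
    {U : Matrix (Fin n) (Fin ρ) ℝ} {σ : Fin ρ → ℝ} {V : Matrix (Fin m) (Fin ρ) ℝ}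
    (hU : Uᵀ * U = 1) (hV : Vᵀ * V = 1) (hσ : ∀ i, 0 < σ i) (hL : L = U * diagonal σ * Vᵀ) :
    svdLeft L * (svdRight L)ᵀ = U * Vᵀ := by
  have hρ := rank_eq_of_orthonormal_diagonal hU hV hσ hL
  subst hρ
  obtain ⟨σ', h'⟩ := isSVD_svdLeft_svdRight L
  exact h'.mul_transpose_unique ⟨hU, hV, hσ, hL⟩

/-- The polar factor `U Vᵀ` of `L = U Σ Vᵀ`. -/
noncomputable def polarFactor {n m : ℕ} (L : Matrix (Fin n) (Fin m) ℝ) : Matrix (Fin n) (Fin m) ℝ :=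
  svdLeft L * (svdRight L)ᵀ

theorem polarFactor_mul_transpose {n m : ℕ} (L : Matrix (Fin n) (Fin m) ℝ)
    {Q : Matrix (Fin m) (Fin m) ℝ} (hQ : Qᵀ * Q = 1) :
    polarFactor (L * Qᵀ) = polarFactor L * Qᵀ := by
  obtain ⟨σ, h⟩ := isSVD_svdLeft_svdRight L
  have e := svdLeft_mul_svdRight_transpose_eq (L := L * Qᵀ) (V := Q * svdRight L)
    h.left_orthonormal
    (by rw [Matrix.transpose_mul, Matrix.mul_assoc, ← Matrix.mul_assoc Qᵀ, hQ, Matrix.one_mul,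
      h.right_orthonormal]) h.pos
    (by rw [Matrix.transpose_mul, ← Matrix.mul_assoc _ _ Qᵀ, ← h.eq])
  rw [polarFactor, e, polarFactor, Matrix.transpose_mul, Matrix.mul_assoc]

/-- The Newton–Schulz iteration for the polar factor. -/
noncomputable def newtonSchulz {n m : ℕ} (L : Matrix (Fin n) (Fin m) ℝ) :
    ℕ → Matrix (Fin n) (Fin m) ℝ
  | 0 => (√(Lᵀ * L).trace)⁻¹ • L
  | k + 1 => (3 / 2 : ℝ) • newtonSchulz L k
      - (1 / 2 : ℝ) • (newtonSchulz L k * ((newtonSchulz L k)ᵀ * newtonSchulz L k))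

/-- The Newton–Schulz iteration on a single singular value. -/
noncomputable def newtonSchulzScalar (y : ℝ) : ℕ → ℝ
  | 0 => y
  | k + 1 => 3 / 2 * newtonSchulzScalar y k - 1 / 2 * newtonSchulzScalar y k ^ 3

/-- The iterates stay in `[y, 1]`, and one step multiplies `1 - z` by `(1 - z) (2 + z) / 2 ≤ 1 - y /
2`, so convergence is geometric. -/
theorem tendsto_newtonSchulzScalar {y : ℝ} (h0 : 0 < y) (h1 : y ≤ 1) :
    Filter.Tendsto (newtonSchulzScalar y) Filter.atTop (nhds 1) := by
  have inv : ∀ k, y ≤ newtonSchulzScalar y k ∧ newtonSchulzScalar y k ≤ 1 ∧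
      1 - newtonSchulzScalar y k ≤ (1 - y / 2) ^ k := by
    intro k
    induction k with
    | zero => exact ⟨le_rfl, h1, by simp [newtonSchulzScalar]; linarith⟩
    | succ k ih =>
      obtain ⟨a, b, c⟩ := ih
      set z := newtonSchulzScalar y k
      have e : newtonSchulzScalar y (k + 1) = 3 / 2 * z - 1 / 2 * z ^ 3 := rfl
      rw [e]
      have hz : 0 < z := h0.trans_le a
      refine ⟨?_, ?_, ?_⟩
      · have : 0 ≤ z * ((1 - z) * (1 + z)) :=
          mul_nonneg hz.le (mul_nonneg (by linarith) (by linarith))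
        nlinarith
      · have : 0 ≤ (1 - z) ^ 2 * (2 + z) := by positivity
        nlinarith
      · calc 1 - (3 / 2 * z - 1 / 2 * z ^ 3) = (1 - z) * ((1 - z) * (2 + z) / 2) := by ring
          _ ≤ (1 - y / 2) ^ k * (1 - y / 2) := by
            refine mul_le_mul c ?_ ?_ ?_
            · nlinarith
            · have : 0 ≤ (1 - z) * (2 + z) := mul_nonneg (by linarith) (by linarith)
              linarith
            · exact pow_nonneg (by linarith) k
          _ = _ := (pow_succ _ _).symm
  have hlim : Filter.Tendsto (fun k => 1 - (1 - y / 2) ^ k) Filter.atTop (nhds 1) := by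
    have := (tendsto_pow_atTop_nhds_zero_of_lt_one (r := 1 - y / 2) (by linarith)
      (by linarith)).const_sub 1
    simpa using this
  exact tendsto_of_tendsto_of_tendsto_of_le_of_le hlim tendsto_const_nhds
    (fun k => by have := (inv k).2.2; linarith) (fun k => (inv k).2.1)

/-- The step is an odd polynomial, so it keeps `U` and `V` and acts on each singular value
separately. -/
theorem newtonSchulz_eq {n m ρ : ℕ} {L : Matrix (Fin n) (Fin m) ℝ}
    {U : Matrix (Fin n) (Fin ρ) ℝ} {σ : Fin ρ → ℝ} {V : Matrix (Fin m) (Fin ρ) ℝ}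
    (hU : Uᵀ * U = 1) (hV : Vᵀ * V = 1) (hL : L = U * diagonal σ * Vᵀ) (k : ℕ) :
    newtonSchulz L k
      = U * diagonal (fun i => newtonSchulzScalar ((√(∑ i, σ i ^ 2))⁻¹ * σ i) k) * Vᵀ := by
  have hV' : ∀ {q : ℕ} (X : Matrix (Fin ρ) (Fin q) ℝ), Vᵀ * (V * X) = X := by
    intro q X; rw [← Matrix.mul_assoc, hV, Matrix.one_mul]
  have hU' : ∀ {q : ℕ} (X : Matrix (Fin ρ) (Fin q) ℝ), Uᵀ * (U * X) = X := by
    intro q X; rw [← Matrix.mul_assoc, hU, Matrix.one_mul]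
  induction k with
  | zero =>
    have htr : (Lᵀ * L).trace = ∑ i, σ i ^ 2 := by
      have : Lᵀ * L = V * (diagonal σ * diagonal σ * Vᵀ) := by
        rw [hL]
        simp only [Matrix.transpose_mul, Matrix.transpose_transpose, Matrix.diagonal_transpose,
          Matrix.mul_assoc, hU']
      rw [this, Matrix.trace_mul_comm, Matrix.mul_assoc, hV, Matrix.mul_one,
        Matrix.diagonal_mul_diagonal, Matrix.trace_diagonal]
      exact Finset.sum_congr rfl fun i _ => (sq _).symm
    have e : diagonal (fun i => newtonSchulzScalar ((√(∑ i, σ i ^ 2))⁻¹ * σ i) 0)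
        = (√(∑ i, σ i ^ 2))⁻¹ • diagonal σ := by
      rw [← Matrix.diagonal_smul]; rfl
    rw [e, newtonSchulz, htr, Matrix.mul_smul, Matrix.smul_mul, ← hL]
  | succ k ih =>
    set y : Fin ρ → ℝ := fun i => newtonSchulzScalar ((√(∑ i, σ i ^ 2))⁻¹ * σ i) k
    have e : diagonal (fun i => newtonSchulzScalar ((√(∑ i, σ i ^ 2))⁻¹ * σ i) (k + 1))
        = (3 / 2 : ℝ) • diagonal y - (1 / 2 : ℝ) • (diagonal y * (diagonal y * diagonal y)) := by
      rw [Matrix.diagonal_mul_diagonal, Matrix.diagonal_mul_diagonal, ← Matrix.diagonal_smul,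
        ← Matrix.diagonal_smul, Matrix.diagonal_sub]
      congr 1
      ext i
      simp only [newtonSchulzScalar, Pi.smul_apply, smul_eq_mul, y]
      ring
    rw [e, newtonSchulz, ih]
    simp only [Matrix.transpose_mul, Matrix.transpose_transpose, Matrix.diagonal_transpose,
      Matrix.mul_assoc, hU', hV', Matrix.sub_mul, Matrix.mul_sub, Matrix.smul_mul, Matrix.mul_smul]

theorem tendsto_newtonSchulz {n m : ℕ} (L : Matrix (Fin n) (Fin m) ℝ) (i : Fin n) (j : Fin m) :
    Filter.Tendsto (fun k => newtonSchulz L k i j) Filter.atTop (nhds (polarFactor L i j)) := by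
  obtain ⟨σ, h⟩ := isSVD_svdLeft_svdRight L
  have e : ∀ y : Fin L.rank → ℝ, (svdLeft L * diagonal y * (svdRight L)ᵀ) i j
      = ∑ a, svdLeft L i a * y a * svdRight L j a := by
    intro y
    rw [Matrix.mul_apply]
    simp [Matrix.mul_diagonal]
  have e1 : polarFactor L i j = ∑ a, svdLeft L i a * 1 * svdRight L j a := by
    rw [← e, show (diagonal fun _ => (1 : ℝ)) = (1 : Matrix (Fin L.rank) (Fin L.rank) ℝ) from
      Matrix.diagonal_one, Matrix.mul_one, polarFactor]
  rw [e1]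
  simp_rw [newtonSchulz_eq h.left_orthonormal h.right_orthonormal h.eq, e]
  refine tendsto_finsetSum _ fun a _ => ((tendsto_newtonSchulzScalar ?_ ?_).const_mul _).mul_const _
  · have : 0 < ∑ i, σ i ^ 2 :=
      Finset.sum_pos (fun i _ => pow_pos (h.pos i) 2) ⟨a, Finset.mem_univ a⟩
    have := h.pos a
    positivity
  -- Division by the Frobenius norm puts every singular value in `(0, 1]`.
  · have hs : 0 < ∑ i, σ i ^ 2 :=
      Finset.sum_pos (fun i _ => pow_pos (h.pos i) 2) ⟨a, Finset.mem_univ a⟩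
    rw [inv_mul_le_iff₀ (Real.sqrt_pos.2 hs), mul_one]
    exact Real.le_sqrt_of_sq_le
      (Finset.single_le_sum (f := fun i => σ i ^ 2) (fun i _ => sq_nonneg _) (Finset.mem_univ a))

theorem measurable_matrix_entry {n m : ℕ} (i : Fin n) (j : Fin m) :
    Measurable fun L : Matrix (Fin n) (Fin m) ℝ => L i j :=
  (measurable_pi_apply j).comp (measurable_pi_apply (X := fun _ : Fin n => Fin m → ℝ) i)

theorem measurable_newtonSchulz {n m : ℕ} (k : ℕ) (i : Fin n) (j : Fin m) :
    Measurable fun L : Matrix (Fin n) (Fin m) ℝ => newtonSchulz L k i j := by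
  induction k generalizing i j with
  | zero =>
    simp only [newtonSchulz, Matrix.smul_apply, smul_eq_mul, Matrix.trace, Matrix.diag_apply,
      Matrix.mul_apply, Matrix.transpose_apply]
    have := @measurable_matrix_entry n m
    fun_prop
  | succ k ih =>
    simp only [newtonSchulz, Matrix.sub_apply, Matrix.smul_apply, smul_eq_mul, Matrix.mul_apply,
      Matrix.transpose_apply]
    fun_prop

/-- The decomposition comes from a choice, so measurability is not visible in the definition. It
follows from the pointwise limit of the Newton–Schulz iterates, whose entries are measurable, and
Tonelli requires it below. -/
theorem measurable_polarFactor {n m : ℕ} (i : Fin n) (j : Fin m) :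
    Measurable fun L : Matrix (Fin n) (Fin m) ℝ => polarFactor L i j :=
  measurable_of_tendsto_metrizable (fun k => measurable_newtonSchulz k i j)
    (tendsto_pi_nhds.2 fun L => tendsto_newtonSchulz L i j)

/-! ### Permeance, leverage and the left incoherence -/

theorem permeance_mul_dotProduct_le {n r : ℕ} (S : Matrix (Fin n) (Fin r) ℝ) (hn : 0 < n)
    (v : Fin r → ℝ) : n * permeance S * (v ⬝ᵥ v) ≤ S *ᵥ v ⬝ᵥ S *ᵥ v := by
  have hn' : (n : ℝ) ≠ 0 := by exact_mod_cast hn.ne'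
  rw [permeance, ← mul_assoc, mul_one_div_cancel hn', one_mul]
  by_cases hv : v = 0
  · simp [hv]
  let x : EuclideanSpace ℝ (Fin r) := WithLp.toLp 2 v
  have hx : x ≠ 0 := fun h => hv (congrArg WithLp.ofLp h)
  have hx' : ‖x‖ ≠ 0 := norm_ne_zero_iff.2 hx
  have hmem : (‖x‖⁻¹ • x) ∈ Metric.sphere (0 : EuclideanSpace ℝ (Fin r)) 1 := by
    rw [mem_sphere_zero_iff_norm, norm_smul, norm_inv, norm_norm, inv_mul_cancel₀ hx']
  have h := ciInf_le (f := fun u : Metric.sphere (0 : EuclideanSpace ℝ (Fin r)) 1 =>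
    ‖Matrix.toEuclideanLin S u‖ ^ 2) ⟨0, by rintro _ ⟨u, rfl⟩; exact sq_nonneg _⟩ ⟨_, hmem⟩
  simp only [map_smul, norm_smul, norm_inv, norm_norm, mul_pow, inv_pow] at h
  rw [← div_eq_inv_mul, le_div_iff₀ (by positivity), norm_toLp_sq] at h
  refine h.trans (le_of_eq ?_)
  rw [← norm_toLp_sq]
  rfl

theorem pos_of_permeance_pos {n r : ℕ} {S : Matrix (Fin n) (Fin r) ℝ} (hν : 0 < permeance S) :
    0 < n ∧ 0 < r := by
  constructor <;> refine Nat.pos_of_ne_zero ?_ <;> rintro rfl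
  · simp [permeance] at hν
  -- For `r = 0` the unit sphere is empty, and a real infimum over an empty type is `0`.
  · have : IsEmpty (Metric.sphere (0 : EuclideanSpace ℝ (Fin 0)) 1) :=
      ⟨fun u => by have := mem_sphere_zero_iff_norm.1 u.2; simp [Subsingleton.elim u.1 0] at this⟩
    rw [permeance, Real.iInf_of_isEmpty, mul_zero] at hν
    exact lt_irrefl _ hν

/-- The leverage bound: the `k`-th coordinate of the projection of `e_k` onto a subspace of the
column space of `S`. -/
theorem leverage_le {n r : ℕ} {S : Matrix (Fin n) (Fin r) ℝ} (hS : IsSignMatrix S)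
    (hν : 0 < permeance S) {v : Fin r → ℝ} {k : Fin n}
    (hk : S *ᵥ v ⬝ᵥ S *ᵥ v = (S *ᵥ v) k) : (S *ᵥ v) k ≤ r / (n * permeance S) := by
  obtain ⟨hn, hr⟩ := pos_of_permeance_pos hν
  have hn' : (0 : ℝ) < n := by exact_mod_cast hn
  have h1 := permeance_mul_dotProduct_le S hn v
  have h2 : (S *ᵥ v) k ^ 2 ≤ r * (v ⬝ᵥ v) := by
    have := Finset.sum_mul_sq_le_sq_mul_sq Finset.univ (fun j => S k j) v
    have e : ∑ j, S k j ^ 2 = r := by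
      have : ∀ j, S k j ^ 2 = 1 := fun j => by rcases hS k j with h | h <;> rw [h] <;> norm_num
      simp [this]
    rw [e] at this
    simpa [mulVec, dotProduct, sq] using this
  rw [hk] at h1
  have h0 : 0 ≤ (S *ᵥ v) k := by
    rw [← hk]; exact Finset.sum_nonneg fun i _ => mul_self_nonneg _
  rcases h0.eq_or_lt with h | h
  · rw [← h]; positivity
  · rw [le_div_iff₀ (by positivity)]
    -- Cauchy–Schwarz and the permeance bound are chained through `v ⬝ᵥ v`; one positive factor `(S
    -- v)_k` then cancels.
    have h3 : n * permeance S * (S *ᵥ v) k ^ 2 ≤ r * (S *ᵥ v) k := by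
      calc _ ≤ n * permeance S * (r * (v ⬝ᵥ v)) := by gcongr
        _ = r * (n * permeance S * (v ⬝ᵥ v)) := by ring
        _ ≤ _ := by gcongr
    nlinarith

/-- Positive permeance makes `Sᵀ S` injective. The left inverse recovers `G` from the loadings
matrix, both for the rank and for the law. -/
theorem exists_left_inverse {n r : ℕ} {S : Matrix (Fin n) (Fin r) ℝ} (hν : 0 < permeance S) :
    ∃ T : Matrix (Fin r) (Fin n) ℝ, T * S = 1 := by
  obtain ⟨hn, hr⟩ := pos_of_permeance_pos hν
  have hn' : (0 : ℝ) < n := by exact_mod_cast hn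
  have hinj : Function.Injective (Sᵀ * S).mulVec := by
    refine (injective_iff_map_eq_zero (Matrix.mulVecLin (Sᵀ * S))).2 fun v hv => ?_
    have h0 : S *ᵥ v ⬝ᵥ S *ᵥ v = 0 := by
      rw [Matrix.dotProduct_mulVec, Matrix.vecMul_mulVec, ← Matrix.dotProduct_mulVec]
      have hv' : (Sᵀ * S) *ᵥ v = 0 := hv
      simp [hv']
    have h1 := permeance_mul_dotProduct_le S hn v
    rw [h0] at h1
    have h2 : v ⬝ᵥ v ≤ 0 := by
      by_contra hc
      have : 0 < n * permeance S * (v ⬝ᵥ v) := by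
        have := not_le.1 hc; positivity
      linarith
    exact dotProduct_self_eq_zero.1
      (le_antisymm h2 (Finset.sum_nonneg fun i _ => mul_self_nonneg _))
  have hu := (Matrix.isUnit_iff_isUnit_det _).1 (Matrix.mulVec_injective_iff_isUnit.1 hinj)
  exact ⟨(Sᵀ * S)⁻¹ * Sᵀ, by rw [Matrix.mul_assoc, Matrix.nonsing_inv_mul _ hu]⟩

theorem rank_loadingsMatrix {n r m : ℕ} {S : Matrix (Fin n) (Fin r) ℝ} (hν : 0 < permeance S)
    {G : Matrix (Fin m) (Fin r) ℝ} (hG : G.rank = r) : (loadingsMatrix S G).rank = r := by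
  obtain ⟨hn, hr⟩ := pos_of_permeance_pos hν
  obtain ⟨T, hT⟩ := exists_left_inverse hν
  have hr' : √(r : ℝ) ≠ 0 := by
    have : (0 : ℝ) < r := by exact_mod_cast hr
    positivity
  have e : Gᵀ = (√(r : ℝ) • T) * loadingsMatrix S G := by
    rw [loadingsMatrix, Matrix.smul_mul, Matrix.mul_smul, smul_smul, mul_one_div_cancel hr',
      one_smul, ← Matrix.mul_assoc, hT, Matrix.one_mul]
  refine le_antisymm ?_ ?_
  · rw [loadingsMatrix, ← Matrix.mul_smul]
    exact (rank_mul_le_left _ _).trans (by simpa using rank_le_width S)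
  · calc r = Gᵀ.rank := by rw [rank_transpose, hG]
      _ ≤ _ := by
        conv_lhs => rw [e]
        exact rank_mul_le_right _ _

theorem loadingsMatrix_mulVec {n r m : ℕ} (S : Matrix (Fin n) (Fin r) ℝ)
    (G : Matrix (Fin m) (Fin r) ℝ) (x : Fin m → ℝ) :
    loadingsMatrix S G *ᵥ x = S *ᵥ (((1 / √(r : ℝ)) • Gᵀ) *ᵥ x) := by
  rw [loadingsMatrix, ← Matrix.mul_smul, Matrix.mulVec_mulVec]

/-- The orthogonal projection `p` of `e_k` onto a matrix range is in the range and `‖p‖² = p_k`. -/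
theorem starProjection_ran_single {n m : ℕ} (L : Matrix (Fin n) (Fin m) ℝ) (k : Fin n) :
    ∃ x : Fin m → ℝ, L *ᵥ x ⬝ᵥ L *ᵥ x = (L *ᵥ x) k ∧
      ‖(ran L).starProjection (EuclideanSpace.single k (1 : ℝ))‖ ^ 2 = (L *ᵥ x) k := by
  obtain ⟨x, hx⟩ := (ran L).starProjection_apply_mem (EuclideanSpace.single k (1 : ℝ))
  set p := (ran L).starProjection (EuclideanSpace.single k (1 : ℝ)) with hp
  have hx' : p = WithLp.toLp 2 (L *ᵥ x.ofLp) := hx.symm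
  have h1 : ‖p‖ ^ 2 = L *ᵥ x.ofLp ⬝ᵥ L *ᵥ x.ofLp := by rw [hx', norm_toLp_sq]
  have h2 : ‖p‖ ^ 2 = (L *ᵥ x.ofLp) k := by
    have : inner ℝ p (EuclideanSpace.single k (1 : ℝ)) = ‖p‖ ^ 2 := by
      have h0 := (ran L).starProjection_inner_eq_zero (EuclideanSpace.single k (1 : ℝ)) p
        ((ran L).starProjection_apply_mem _)
      rw [← hp, inner_sub_left, sub_eq_zero, real_inner_self_eq_norm_sq] at h0
      rw [real_inner_comm, h0]
    rw [← this, hx', EuclideanSpace.inner_single_right]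
    simp
  exact ⟨x.ofLp, h1.symm.trans h2, h2⟩

theorem leftIncoherence_loadingsMatrix_le {n r m : ℕ} {S : Matrix (Fin n) (Fin r) ℝ}
    (hS : IsSignMatrix S) (hν : 0 < permeance S) {G : Matrix (Fin m) (Fin r) ℝ} (hG : G.rank = r) :
    leftIncoherence (loadingsMatrix S G) ≤ (permeance S)⁻¹ := by
  obtain ⟨hn, hr⟩ := pos_of_permeance_pos hν
  have hn' : (0 : ℝ) < n := by exact_mod_cast hn
  have hr' : (0 : ℝ) < r := by exact_mod_cast hr
  have : Nonempty (Fin n) := ⟨⟨0, hn⟩⟩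
  rw [leftIncoherence, rank_loadingsMatrix hν hG]
  have h : ⨆ k : Fin n, ‖(ran (loadingsMatrix S G)).starProjection
      (EuclideanSpace.single k (1 : ℝ))‖ ^ 2 ≤ r / (n * permeance S) := by
    refine ciSup_le fun k => ?_
    obtain ⟨x, h1, h2⟩ := starProjection_ran_single (loadingsMatrix S G) k
    rw [loadingsMatrix_mulVec] at h1 h2
    rw [h2]
    exact leverage_le hS hν h1
  calc _ ≤ (n : ℝ) / r * (r / (n * permeance S)) := by gcongr
    _ = _ := by field_simp

/-! ### Columns and rows of the polar factor -/

theorem polarFactor_mulVec_dotProduct {n m : ℕ} (L : Matrix (Fin n) (Fin m) ℝ) (h : Fin m → ℝ) :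
    polarFactor L *ᵥ h ⬝ᵥ polarFactor L *ᵥ h = (svdRight L)ᵀ *ᵥ h ⬝ᵥ (svdRight L)ᵀ *ᵥ h := by
  obtain ⟨σ, hs⟩ := isSVD_svdLeft_svdRight L
  rw [polarFactor, ← Matrix.mulVec_mulVec,
    dotProduct_mulVec_mulVec_of_orthogonal hs.left_orthonormal]

theorem norm_sq_starProjection_ran_transpose_le {n m : ℕ} (L : Matrix (Fin n) (Fin m) ℝ)
    (l : Fin m) : ‖(ran Lᵀ).starProjection (EuclideanSpace.single l (1 : ℝ))‖ ^ 2
      ≤ polarFactor L *ᵥ Pi.single l 1 ⬝ᵥ polarFactor L *ᵥ Pi.single l 1 := by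
  obtain ⟨σ, h⟩ := isSVD_svdLeft_svdRight L
  obtain ⟨x, h1, h2⟩ := starProjection_ran_single Lᵀ l
  set U := svdLeft L
  set V := svdRight L
  have e : Lᵀ *ᵥ x = V *ᵥ ((diagonal σ * Uᵀ) *ᵥ x) := by
    conv_lhs => rw [h.eq]
    simp only [Matrix.transpose_mul, Matrix.transpose_transpose, Matrix.diagonal_transpose,
      Matrix.mulVec_mulVec, Matrix.mul_assoc]
  set a := (diagonal σ * Uᵀ) *ᵥ x
  rw [e] at h1 h2
  rw [dotProduct_mulVec_mulVec_of_orthogonal h.right_orthonormal] at h1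
  have h3 : (V *ᵥ a) l = a ⬝ᵥ Vᵀ *ᵥ Pi.single l 1 := by
    rw [Matrix.dotProduct_mulVec, Matrix.vecMul_transpose]
    simp
  rw [h2, polarFactor_mulVec_dotProduct]
  set b := Vᵀ *ᵥ Pi.single l 1
  -- The projection of `e_l` is `V a` with `‖a‖² = ⟨a, b⟩`, so `‖a - b‖² ≥ 0` yields `‖a‖² ≤ ‖b‖²`.
  have h4 : 0 ≤ (a - b) ⬝ᵥ (a - b) := Finset.sum_nonneg fun i _ => mul_self_nonneg _
  rw [sub_dotProduct, dotProduct_sub, dotProduct_sub, dotProduct_comm b a, ← h3, h1] at h4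
  linarith

/-- Row `k` of `U Vᵀ` is as long as row `U_k`, and `‖U_k‖² = (U U_k)_k = ‖U U_k‖²`. Since `U = L V
Σ⁻¹`, the vector `U U_k` lies in the range of `S` and the leverage bound applies. -/
theorem polarFactor_row_dotProduct_le {n r m : ℕ} {S : Matrix (Fin n) (Fin r) ℝ}
    (hS : IsSignMatrix S) (hν : 0 < permeance S) (G : Matrix (Fin m) (Fin r) ℝ) (k : Fin n) :
    polarFactor (loadingsMatrix S G) k ⬝ᵥ polarFactor (loadingsMatrix S G) k
      ≤ r / (n * permeance S) := by
  obtain ⟨σ, h⟩ := isSVD_svdLeft_svdRight (loadingsMatrix S G)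
  have hpol : polarFactor (loadingsMatrix S G)
    = svdLeft (loadingsMatrix S G) * (svdRight (loadingsMatrix S G))ᵀ := rfl
  rw [hpol]
  have hspan : ∀ y, ∃ v, svdLeft (loadingsMatrix S G) *ᵥ y = S *ᵥ v := by
    intro y
    refine ⟨_, Eq.trans ?_ (loadingsMatrix_mulVec S G
      (svdRight (loadingsMatrix S G) *ᵥ (diagonal (fun i => (σ i)⁻¹) *ᵥ y)))⟩
    have e2 : diagonal σ * diagonal (fun i => (σ i)⁻¹) = 1 := by
      rw [Matrix.diagonal_mul_diagonal]
      simp [(h.pos _).ne']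
    have e3 : svdLeft (loadingsMatrix S G) = loadingsMatrix S G *
        (svdRight (loadingsMatrix S G) * diagonal (fun i => (σ i)⁻¹)) := by
      calc _ = svdLeft (loadingsMatrix S G) * (diagonal σ * (((svdRight (loadingsMatrix S G))ᵀ *
            svdRight (loadingsMatrix S G)) * diagonal (fun i => (σ i)⁻¹))) := by
            rw [h.right_orthonormal, Matrix.one_mul, e2, Matrix.mul_one]
        _ = (svdLeft (loadingsMatrix S G) * diagonal σ * (svdRight (loadingsMatrix S G))ᵀ) *
            (svdRight (loadingsMatrix S G) * diagonal (fun i => (σ i)⁻¹)) := by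
            simp only [Matrix.mul_assoc]
        _ = _ := by rw [← h.eq]
    conv_lhs => rw [e3]
    simp only [Matrix.mulVec_mulVec]
  generalize svdLeft (loadingsMatrix S G) = U at h hspan ⊢
  generalize svdRight (loadingsMatrix S G) = V at h ⊢
  have hrow : (U * Vᵀ) k = V *ᵥ U k := by
    ext j
    simp only [Matrix.mul_apply, Matrix.transpose_apply, mulVec, dotProduct]
    exact Finset.sum_congr rfl fun a _ => mul_comm _ _
  rw [hrow, dotProduct_mulVec_mulVec_of_orthogonal h.right_orthonormal]
  obtain ⟨v, hv⟩ := hspan (U k)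
  have hz : U *ᵥ U k ⬝ᵥ U *ᵥ U k = (U *ᵥ U k) k :=
    dotProduct_mulVec_mulVec_of_orthogonal h.left_orthonormal (U k)
  have hk : (U *ᵥ U k) k = U k ⬝ᵥ U k := rfl
  rw [← hk]
  rw [hv] at hz ⊢
  exact leverage_le hS hν hz

/-! ### Exchanging a coordinate vector for an independent normal vector -/

theorem polarFactor_loadingsMatrix_mul {n r m : ℕ} (S : Matrix (Fin n) (Fin r) ℝ)
    (G : Matrix (Fin m) (Fin r) ℝ) {Q : Matrix (Fin m) (Fin m) ℝ} (hQ : Qᵀ * Q = 1) :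
    polarFactor (loadingsMatrix S (Q * G)) = polarFactor (loadingsMatrix S G) * Qᵀ := by
  rw [← polarFactor_mul_transpose _ hQ]
  simp only [loadingsMatrix, Matrix.transpose_mul, Matrix.smul_mul, Matrix.mul_assoc]

theorem measurable_polarFactor_mulVec {n r m : ℕ} (S : Matrix (Fin n) (Fin r) ℝ) :
    Measurable fun p : Matrix (Fin m) (Fin r) ℝ × (Fin m → ℝ) =>
      polarFactor (loadingsMatrix S p.1) *ᵥ p.2 := by
  refine measurable_pi_lambda _ fun i => ?_
  simp only [mulVec, dotProduct]
  refine Finset.measurable_sum _ fun j _ => Measurable.mul ?_ ?_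
  · exact (measurable_polarFactor i j).comp ((measurable_loadingsMatrix S).comp measurable_fst)
  · exact (measurable_pi_apply j).comp measurable_snd

theorem measurableSet_polarFactor_single {n r m : ℕ} (S : Matrix (Fin n) (Fin r) ℝ)
    {Φ : (Fin n → ℝ) → ℝ} (hΦ : Measurable Φ) (τ : ℝ) (x : Fin m → ℝ) :
    MeasurableSet {G : Matrix (Fin m) (Fin r) ℝ |
      τ ≤ Φ (polarFactor (loadingsMatrix S G) *ᵥ x)} := by
  have h : Measurable fun G : Matrix (Fin m) (Fin r) ℝ =>
      polarFactor (loadingsMatrix S G) *ᵥ x := by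
    refine measurable_pi_lambda _ fun i => ?_
    simp only [mulVec, dotProduct]
    exact Finset.measurable_sum _ fun j _ =>
      ((measurable_polarFactor i j).comp (measurable_loadingsMatrix S)).mul_const _
  exact (hΦ.comp h) measurableSet_Ici

/-- If `Q h = ‖h‖ e_l`, then `F(G) h = ‖h‖ F(Q G) e_l`. Quadratic homogeneity of `Φ` cancels `‖h‖²`,
and `Q G` has the law of `G`. -/
theorem stdNormalMatrix_polarFactor_eq {n r m : ℕ} (S : Matrix (Fin n) (Fin r) ℝ)
    {Φ : (Fin n → ℝ) → ℝ} (hΦ : Measurable Φ) (hhom : ∀ (c : ℝ) y, Φ (c • y) = c ^ 2 * Φ y)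
    (τ : ℝ) (l : Fin m) {h : Fin m → ℝ} (hh : h ≠ 0) :
    stdNormalMatrix m r {G | τ * (h ⬝ᵥ h) ≤ Φ (polarFactor (loadingsMatrix S G) *ᵥ h)}
      = stdNormalMatrix m r {G | τ ≤ Φ (polarFactor (loadingsMatrix S G) *ᵥ Pi.single l 1)} := by
  obtain ⟨Q, hQ, hQh⟩ := exists_orthogonal_mulVec_eq h l
  have hnn : 0 ≤ h ⬝ᵥ h := Finset.sum_nonneg fun i _ => mul_self_nonneg _
  have hc2 : √(h ⬝ᵥ h) ^ 2 = h ⬝ᵥ h := Real.sq_sqrt hnn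
  have hpos : 0 < h ⬝ᵥ h := lt_of_le_of_ne hnn fun h0 => hh (dotProduct_self_eq_zero.1 h0.symm)
  have hQt : h = Qᵀ *ᵥ (√(h ⬝ᵥ h) • Pi.single l 1) := by
    rw [← hQh, Matrix.mulVec_mulVec, hQ, Matrix.one_mulVec]
  rw [← (measurePreserving_mul_left r hQ).measure_preimage
    (measurableSet_polarFactor_single S hΦ τ (Pi.single l 1)).nullMeasurableSet]
  congr 1
  ext G
  show τ * (h ⬝ᵥ h) ≤ Φ (polarFactor (loadingsMatrix S G) *ᵥ h)
    ↔ τ ≤ Φ (polarFactor (loadingsMatrix S (Q * G)) *ᵥ Pi.single l 1)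
  have e : polarFactor (loadingsMatrix S G) *ᵥ h
      = √(h ⬝ᵥ h) • (polarFactor (loadingsMatrix S (Q * G)) *ᵥ Pi.single l 1) := by
    rw [polarFactor_loadingsMatrix_mul S G hQ, ← Matrix.mulVec_smul, ← Matrix.mulVec_mulVec, ← hQt]
  rw [e, hhom, hc2, mul_comm τ, mul_le_mul_iff_right₀ hpos]

/-- By rotation invariance a coordinate vector may be replaced by an independent standard normal
vector. -/
theorem measure_polarFactor_single_le {n r m : ℕ} (S : Matrix (Fin n) (Fin r) ℝ)
    {Φ : (Fin n → ℝ) → ℝ} (hΦ : Measurable Φ) (hhom : ∀ (c : ℝ) y, Φ (c • y) = c ^ 2 * Φ y)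
    (τ : ℝ) (ε : ℝ≥0∞)
    (hfix : ∀ᵐ G ∂(stdNormalMatrix m r), (Measure.pi fun _ : Fin m => gaussianReal 0 1)
      {h | τ * (h ⬝ᵥ h) ≤ Φ (polarFactor (loadingsMatrix S G) *ᵥ h)} ≤ ε) (l : Fin m) :
    stdNormalMatrix m r {G | τ ≤ Φ (polarFactor (loadingsMatrix S G) *ᵥ Pi.single l 1)} ≤ ε := by
  have mE : MeasurableSet {p : Matrix (Fin m) (Fin r) ℝ × (Fin m → ℝ) |
      τ * (p.2 ⬝ᵥ p.2) ≤ Φ (polarFactor (loadingsMatrix S p.1) *ᵥ p.2)} := by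
    refine measurableSet_le ?_ (hΦ.comp (measurable_polarFactor_mulVec S))
    have : Measurable fun x : Fin m → ℝ => τ * (x ⬝ᵥ x) := by
      simp only [dotProduct]
      fun_prop
    exact this.comp measurable_snd
  have h0 : ∀ᵐ h ∂(Measure.pi fun _ : Fin m => gaussianReal 0 1), h ≠ 0 := by
    rw [ae_iff]
    exact measure_mono_null (fun x hx => congrFun (not_not.1 hx) l)
      (measure_eq_zero_pi_gaussianReal l)
  calc stdNormalMatrix m r {G | τ ≤ Φ (polarFactor (loadingsMatrix S G) *ᵥ Pi.single l 1)}
      = ∫⁻ _, stdNormalMatrix m r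
          {G | τ ≤ Φ (polarFactor (loadingsMatrix S G) *ᵥ Pi.single l 1)}
          ∂(Measure.pi fun _ : Fin m => gaussianReal 0 1) := by simp
    _ = ∫⁻ h, stdNormalMatrix m r
          {G | τ * (h ⬝ᵥ h) ≤ Φ (polarFactor (loadingsMatrix S G) *ᵥ h)}
          ∂(Measure.pi fun _ : Fin m => gaussianReal 0 1) := by
        refine lintegral_congr_ae ?_
        filter_upwards [h0] with h hh
        exact (stdNormalMatrix_polarFactor_eq S hΦ hhom τ l hh).symm
    -- Tonelli: the probability in `G` averaged over `h` becomes the probability in `h` averaged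
    -- over `G`, where `hfix` applies.
    _ = _ := (Measure.prod_apply_symm mE).symm
    _ = _ := Measure.prod_apply mE
    _ ≤ ∫⁻ _, ε ∂(stdNormalMatrix m r) := lintegral_mono_ae hfix
    _ = ε := by simp

/-! ### Tail bounds for one column and one entry -/

theorem measure_polarFactor_column_le {n r m : ℕ} {S : Matrix (Fin n) (Fin r) ℝ}
    (hν : 0 < permeance S) (hrm : r ≤ m) {t : ℝ} (ht : 2 ≤ t) (l : Fin m) :
    stdNormalMatrix m r {G | r * t / m ≤ polarFactor (loadingsMatrix S G) *ᵥ Pi.single l 1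
      ⬝ᵥ polarFactor (loadingsMatrix S G) *ᵥ Pi.single l 1}
      ≤ ENNReal.ofReal (2 * Real.exp (-t / 2)) := by
  refine measure_polarFactor_single_le S (Φ := fun y => y ⬝ᵥ y) ?_ ?_ _ _ ?_ l
  · simp only [dotProduct]; fun_prop
  · intro c y
    rw [smul_dotProduct, dotProduct_smul, smul_eq_mul, smul_eq_mul]; ring
  · filter_upwards [ae_rank_stdNormalMatrix hrm] with G hG
    have hrank := rank_loadingsMatrix hν hG
    obtain ⟨σ, h⟩ := isSVD_svdLeft_svdRight (loadingsMatrix S G)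
    have := measure_orthonormal_projection_le (hrank.symm ▸ (pos_of_permeance_pos hν).2)
      (hrank.symm ▸ hrm) h.right_orthonormal ht
    simp only [← polarFactor_mulVec_dotProduct] at this
    rwa [hrank] at this

theorem exists_unit_smul_eq {m : ℕ} (hm : 0 < m) (w : Fin m → ℝ) :
    ∃ u : Fin m → ℝ, u ⬝ᵥ u = 1 ∧ w = √(w ⬝ᵥ w) • u := by
  have hnn : 0 ≤ w ⬝ᵥ w := Finset.sum_nonneg fun i _ => mul_self_nonneg _
  by_cases hw : w = 0
  · exact ⟨Pi.single ⟨0, hm⟩ 1, by simp, by simp [hw]⟩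
  · have hpos : 0 < w ⬝ᵥ w :=
      lt_of_le_of_ne hnn fun h => hw (dotProduct_self_eq_zero.1 h.symm)
    have hs : √(w ⬝ᵥ w) ≠ 0 := (Real.sqrt_pos.2 hpos).ne'
    refine ⟨(√(w ⬝ᵥ w))⁻¹ • w, ?_, ?_⟩
    · rw [smul_dotProduct, dotProduct_smul, smul_eq_mul, smul_eq_mul, ← mul_assoc, ← mul_inv,
        Real.mul_self_sqrt hnn, inv_mul_cancel₀ hpos.ne']
    · rw [smul_smul, mul_inv_cancel₀ hs, one_smul]

/-- For fixed `G`, row `k` is `w = ‖w‖ u` with `u` a unit vector, so `⟨w, h⟩² ≤ r / (n ν) ⟨u, h⟩²`.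
The last factor is the projection of `h` onto a single direction. -/
theorem measure_polarFactor_entry_le {n r m : ℕ} {S : Matrix (Fin n) (Fin r) ℝ}
    (hS : IsSignMatrix S) (hν : 0 < permeance S) {t : ℝ} (ht : 2 ≤ t)
    (k : Fin n) (l : Fin m) :
    stdNormalMatrix m r {G | r / (n * permeance S) * (t / m)
      ≤ polarFactor (loadingsMatrix S G) k l ^ 2} ≤ ENNReal.ofReal (2 * Real.exp (-t / 2)) := by
  obtain ⟨hn, hr⟩ := pos_of_permeance_pos hν
  have hn' : (0 : ℝ) < n := by exact_mod_cast hn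
  have hr' : (0 : ℝ) < r := by exact_mod_cast hr
  have hm : 0 < m := l.pos
  have h := measure_polarFactor_single_le S (m := m) (Φ := fun y => y k ^ 2) (by fun_prop)
    (fun c y => by simp [mul_pow]) (r / (n * permeance S) * (t / m))
    (ENNReal.ofReal (2 * Real.exp (-t / 2))) (Filter.Eventually.of_forall fun G => ?_) l
  · simpa using h
  set w := polarFactor (loadingsMatrix S G) k with hw
  obtain ⟨u, hu, hwu⟩ := exists_unit_smul_eq hm w
  have hnn : 0 ≤ w ⬝ᵥ w := Finset.sum_nonneg fun i _ => mul_self_nonneg _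
  let V : Matrix (Fin m) (Fin 1) ℝ := Matrix.of fun i _ => u i
  have hV : Vᵀ * V = 1 := by
    ext i j
    rw [Subsingleton.elim i j, Matrix.one_apply_eq, Matrix.mul_apply]
    exact hu
  refine le_trans (measure_mono fun x hx => ?_)
    (measure_orthonormal_projection_le one_pos hm hV ht)
  have hx' : r / (n * permeance S) * (t / m) * (x ⬝ᵥ x) ≤ (w ⬝ᵥ x) ^ 2 := hx
  have e : Vᵀ *ᵥ x ⬝ᵥ Vᵀ *ᵥ x = (u ⬝ᵥ x) ^ 2 := by
    rw [dotProduct, Fin.sum_univ_one, sq]; rfl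
  show ((1 : ℕ) : ℝ) * t / m * (x ⬝ᵥ x) ≤ Vᵀ *ᵥ x ⬝ᵥ Vᵀ *ᵥ x
  rw [e, Nat.cast_one, one_mul]
  have hwx : (w ⬝ᵥ x) ^ 2 = (w ⬝ᵥ w) * (u ⬝ᵥ x) ^ 2 := by
    conv_lhs => rw [hwu]
    rw [smul_dotProduct, smul_eq_mul, mul_pow, Real.sq_sqrt hnn]
  have hle := polarFactor_row_dotProduct_le hS hν G k
  rw [hwx] at hx'
  have hβ : 0 < r / (n * permeance S) := by positivity
  have : r / (n * permeance S) * (t / m * (x ⬝ᵥ x)) ≤ r / (n * permeance S) * (u ⬝ᵥ x) ^ 2 := by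
    rw [← mul_assoc]
    exact hx'.trans (mul_le_mul_of_nonneg_right hle (sq_nonneg _))
  exact le_of_mul_le_mul_left this hβ

/-! ### Transfer to the given random matrix and union bounds -/

/-- A random matrix with the Gaussian loadings law comes from a standard normal matrix. -/
theorem exists_hasLaw_stdNormalMatrix {n r m : ℕ} {S : Matrix (Fin n) (Fin r) ℝ}
    (hν : 0 < permeance S) {Ω : Type*} [MeasurableSpace Ω] {P : Measure Ω}
    {L₀ : Ω → Matrix (Fin n) (Fin m) ℝ} (hL₀ : HasLaw L₀ (GLM S m) P) :
    ∃ G : Ω → Matrix (Fin m) (Fin r) ℝ, HasLaw G (stdNormalMatrix m r) P ∧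
      ∀ᵐ ω ∂P, L₀ ω = loadingsMatrix S (G ω) := by
  obtain ⟨hn, hr⟩ := pos_of_permeance_pos hν
  obtain ⟨T, hT⟩ := exists_left_inverse hν
  have hr' : √(r : ℝ) ≠ 0 := by
    have : (0 : ℝ) < r := by exact_mod_cast hr
    positivity
  let R : Matrix (Fin n) (Fin m) ℝ → Matrix (Fin m) (Fin r) ℝ := fun L => (√(r : ℝ) • (T * L))ᵀ
  have hR : ∀ G, R (loadingsMatrix S G) = G := by
    intro G
    simp only [R, loadingsMatrix]
    rw [Matrix.mul_smul, smul_smul, mul_one_div_cancel hr', one_smul, ← Matrix.mul_assoc, hT,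
      Matrix.one_mul, Matrix.transpose_transpose]
  have mR : Measurable R := by
    refine measurable_pi_lambda _ fun i => measurable_pi_lambda _ fun j => ?_
    simp only [R, Matrix.transpose_apply, Matrix.smul_apply, Matrix.mul_apply, smul_eq_mul]
    exact (Finset.measurable_sum _ fun k _ => (measurable_matrix_entry k i).const_mul _).const_mul _
  have mS := measurable_loadingsMatrix (m := m) S
  refine ⟨fun ω => R (L₀ ω), ⟨mR.comp_aemeasurable hL₀.aemeasurable, ?_⟩, ?_⟩
  · have : (fun ω => R (L₀ ω)) = R ∘ L₀ := rfl
    rw [this, ← AEMeasurable.map_map_of_aemeasurable mR.aemeasurable hL₀.aemeasurable,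
      hL₀.map_eq, GLM, Measure.map_map mR mS]
    have e : R ∘ loadingsMatrix S = id := funext hR
    rw [e, Measure.map_id]
  -- `L₀` need not take values in the image of `loadingsMatrix S`; being fixed by `loadingsMatrix S
  -- ∘ R` is a measurable condition that holds almost surely under `GLM S m`.
  · have hset : MeasurableSet {L : Matrix (Fin n) (Fin m) ℝ | L = loadingsMatrix S (R L)} := by
      have : {L : Matrix (Fin n) (Fin m) ℝ | L = loadingsMatrix S (R L)}
          = ⋂ i, ⋂ j, {L | L i j = loadingsMatrix S (R L) i j} := by
        ext L
        simp [← Matrix.ext_iff]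
      rw [this]
      exact MeasurableSet.iInter fun i => MeasurableSet.iInter fun j =>
        measurableSet_eq_fun (measurable_matrix_entry i j)
          ((measurable_matrix_entry i j).comp (mS.comp mR))
    have h : ∀ᵐ L ∂(GLM S m), L = loadingsMatrix S (R L) := by
      rw [GLM, ae_map_iff mS.aemeasurable hset]
      exact Filter.Eventually.of_forall fun G => by rw [hR]
    rw [← hL₀.map_eq] at h
    exact ae_of_ae_map hL₀.aemeasurable h

/-- The left side is `(n + m)^{-2(α+1)}`, and `n m ≤ (n + m)²`. -/
theorem exp_neg_log_le {n m : ℕ} (hn : 0 < n) (hm : 0 < m) {α : ℝ} (hα : 0 < α) :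
    Real.exp (-(4 * (α + 1) * Real.log ((n : ℝ) + m)) / 2)
      ≤ ((n : ℝ) * m) ^ (-α) / ((n : ℝ) * m) := by
  have hn' : (1 : ℝ) ≤ n := by exact_mod_cast hn
  have hm' : (1 : ℝ) ≤ m := by exact_mod_cast hm
  have hnm : (0 : ℝ) < n * m := by positivity
  rw [← Real.rpow_sub_one hnm.ne', Real.rpow_def_of_pos hnm]
  refine Real.exp_le_exp.2 ?_
  have h : Real.log ((n : ℝ) * m) ≤ 2 * Real.log ((n : ℝ) + m) := by
    rw [← Real.log_rpow (by positivity)]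
    refine Real.log_le_log hnm ?_
    norm_num
    nlinarith
  nlinarith

/-- Since `4 log 2 > 2`, the chosen `t` always meets the condition `t ≥ 2` of the tail bounds. -/
theorem two_le_mul_log {n m : ℕ} (hn : 0 < n) (hm : 0 < m) {α : ℝ} (hα : 0 < α) :
    2 ≤ 4 * (α + 1) * Real.log ((n : ℝ) + m) := by
  have hn' : (1 : ℝ) ≤ n := by exact_mod_cast hn
  have hm' : (1 : ℝ) ≤ m := by exact_mod_cast hm
  have h1 : Real.log 2 ≤ Real.log ((n : ℝ) + m) := Real.log_le_log (by norm_num) (by linarith)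
  have h2 := Real.log_two_gt_d9
  nlinarith

theorem mainTheorem8 {n r m : ℕ} (S : Matrix (Fin n) (Fin r) ℝ) (hS : IsSignMatrix S)
    (hν : 0 < permeance S) (hm : r ≤ m)
    {Ω : Type*} [MeasurableSpace Ω] (P : Measure Ω) [IsProbabilityMeasure P]
    (L₀ : Ω → Matrix (Fin n) (Fin m) ℝ) (hL₀ : HasLaw L₀ (GLM S m) P) :
    (∀ G : Matrix (Fin m) (Fin r) ℝ, G.rank = r →
      leftIncoherence (loadingsMatrix S G) ≤ (permeance S)⁻¹) ∧
    (∀ᵐ ω ∂P, (L₀ ω).rank = r ∧ leftIncoherence (L₀ ω) ≤ (permeance S)⁻¹) ∧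
    ∀ α : ℝ, 0 < α →
      P {ω | rightIncoherence (L₀ ω) ≥ 4 * (α + 1) * Real.log ((n : ℝ) + m)} ≤
          ENNReal.ofReal (2 * ((n : ℝ) * m) ^ (-α) / n) ∧
      P {ω | jointIncoherence (L₀ ω) ≥
            4 * (α + 1) / permeance S * Real.log ((n : ℝ) + m)} ≤
          ENNReal.ofReal (2 * ((n : ℝ) * m) ^ (-α)) := by
  obtain ⟨hn, hr⟩ := pos_of_permeance_pos hν
  have hm0 : 0 < m := hr.trans_le hm
  have hn' : (0 : ℝ) < n := by exact_mod_cast hn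
  have hr' : (0 : ℝ) < r := by exact_mod_cast hr
  have hm' : (0 : ℝ) < m := by exact_mod_cast hm0
  have : Nonempty (Fin n) := ⟨⟨0, hn⟩⟩
  have : Nonempty (Fin m) := ⟨⟨0, hm0⟩⟩
  obtain ⟨G, hG, hLG⟩ := exists_hasLaw_stdNormalMatrix hν hL₀
  have hrank : ∀ᵐ ω ∂P, (G ω).rank = r := by
    have h := ae_rank_stdNormalMatrix hm
    rw [← hG.map_eq] at h
    exact ae_of_ae_map hG.aemeasurable h
  -- An inequality suffices and holds for all sets, measurable or not.
  have hpre : ∀ s, P (G ⁻¹' s) ≤ stdNormalMatrix m r s := fun s => by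
    rw [← hG.map_eq]
    exact Measure.le_map_apply hG.aemeasurable s
  refine ⟨fun G hG => leftIncoherence_loadingsMatrix_le hS hν hG, ?_, fun α hα => ⟨?_, ?_⟩⟩
  · filter_upwards [hLG, hrank] with ω h1 h2
    rw [h1]
    exact ⟨rank_loadingsMatrix hν h2, leftIncoherence_loadingsMatrix_le hS hν h2⟩
  · set t := 4 * (α + 1) * Real.log ((n : ℝ) + m) with htdef
    have ht : 2 ≤ t := two_le_mul_log hn hm0 hα
    have hexp := exp_neg_log_le hn hm0 hα
    rw [← htdef] at hexp
    let B : Fin m → Set (Matrix (Fin m) (Fin r) ℝ) := fun l =>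
      {G | r * t / m ≤ polarFactor (loadingsMatrix S G) *ᵥ Pi.single l 1
        ⬝ᵥ polarFactor (loadingsMatrix S G) *ᵥ Pi.single l 1}
    calc _ ≤ P (⋃ l, G ⁻¹' B l) := by
          refine measure_mono_ae ?_
          filter_upwards [hLG, hrank] with ω h1 h2 h3
          have h3' : t ≤ rightIncoherence (L₀ ω) := h3
          rw [h1, rightIncoherence, rank_loadingsMatrix hν h2] at h3'
          obtain ⟨l, hl⟩ := exists_eq_ciSup_of_finite (f := fun l : Fin m =>
            ‖(ran (loadingsMatrix S (G ω))ᵀ).starProjection (EuclideanSpace.single l (1 : ℝ))‖ ^ 2)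
          rw [← hl] at h3'
          refine Set.mem_iUnion.2 ⟨l, ?_⟩
          refine le_trans ?_ (norm_sq_starProjection_ran_transpose_le (loadingsMatrix S (G ω)) l)
          rw [div_le_iff₀ hm']
          rw [div_mul_eq_mul_div, le_div_iff₀ hr'] at h3'
          linarith
      _ ≤ ∑ l, P (G ⁻¹' B l) := measure_iUnion_fintype_le _ _
      _ ≤ ∑ _l : Fin m, ENNReal.ofReal (2 * (((n : ℝ) * m) ^ (-α) / ((n : ℝ) * m))) :=
          Finset.sum_le_sum fun l _ => ((hpre _).trans
            (measure_polarFactor_column_le hν hm ht l)).trans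
              (ENNReal.ofReal_le_ofReal (by linarith))
      -- The `m` columns cost a factor `m`, which leaves `1 / n` of the `1 / (n m)`.
      _ = _ := by
          rw [Finset.sum_const, Finset.card_univ, Fintype.card_fin, ← ENNReal.ofReal_nsmul,
            nsmul_eq_mul]
          congr 1
          field_simp
  · set t := 4 * (α + 1) * Real.log ((n : ℝ) + m) with htdef
    have ht : 2 ≤ t := two_le_mul_log hn hm0 hα
    have hexp := exp_neg_log_le hn hm0 hα
    rw [← htdef] at hexp
    let B : Fin n × Fin m → Set (Matrix (Fin m) (Fin r) ℝ) := fun kl =>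
      {G | r / (n * permeance S) * (t / m) ≤ polarFactor (loadingsMatrix S G) kl.1 kl.2 ^ 2}
    calc _ ≤ P (⋃ kl, G ⁻¹' B kl) := by
          refine measure_mono_ae ?_
          filter_upwards [hLG, hrank] with ω h1 h2 h3
          have h3' : 4 * (α + 1) / permeance S * Real.log ((n : ℝ) + m)
            ≤ jointIncoherence (L₀ ω) := h3
          have hj : ∀ L : Matrix (Fin n) (Fin m) ℝ, jointIncoherence L = (n : ℝ) * m / L.rank *
            ⨆ kl : Fin n × Fin m, |polarFactor L kl.1 kl.2| ^ 2 := fun L => rfl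
          rw [h1, hj, rank_loadingsMatrix hν h2] at h3'
          obtain ⟨kl, hkl⟩ := exists_eq_ciSup_of_finite (f := fun kl : Fin n × Fin m =>
            |polarFactor (loadingsMatrix S (G ω)) kl.1 kl.2| ^ 2)
          rw [← hkl, sq_abs, div_mul_eq_mul_div, ← htdef, div_mul_eq_mul_div, div_le_div_iff₀ hν hr'] at h3'
          refine Set.mem_iUnion.2 ⟨kl, ?_⟩
          show r / (n * permeance S) * (t / m) ≤ _
          rw [div_mul_div_comm, div_le_iff₀ (by positivity)]
          linarith
      _ ≤ ∑ kl, P (G ⁻¹' B kl) := measure_iUnion_fintype_le _ _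
      _ ≤ ∑ _kl : Fin n × Fin m, ENNReal.ofReal (2 * (((n : ℝ) * m) ^ (-α) / ((n : ℝ) * m))) :=
          Finset.sum_le_sum fun kl _ => ((hpre _).trans
            (measure_polarFactor_entry_le hS hν ht kl.1 kl.2)).trans
              (ENNReal.ofReal_le_ofReal (by linarith))
      -- The `n m` entries use up the whole factor `1 / (n m)`.
      _ = _ := by
          rw [Finset.sum_const, Finset.card_univ, Fintype.card_prod, Fintype.card_fin,
            Fintype.card_fin, ← ENNReal.ofReal_nsmul, nsmul_eq_mul]
          congr 1
          push_cast
          field_simp
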